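/- **Conventions.** "Computable" means S1-S9-computable in the sense of Kleene, over the total objects of finite type: $\{e\}(\vec a)=v$ says that the computation with index $e\in\mathbb N$ on the list of arguments $\vec a$ terminates with value $v\in\mathbb N$. Kleene's quantifier $\exists^2:\mathbb N^{\mathbb N}\to\{0,1\}$ is given by $\exists^2(h)=0\leftrightarrow(\exists n)(h(n)=0)$. The Suslin functional $\mathsf S^2:\mathbb N^{\mathbb N}\to\{0,1\}$ is given by $\mathsf S^2(h)=0\leftrightarrow(\exists g\in\mathbb N^{\mathbb N})(\forall n)\,(h(\overline{g}n)=0)$, where $\overline gn$ codes $\langle g(0),\dots,g(n-1)\rangle$. Rationals are coded by natural numbers in a fixed elementary way. A name of $x\in\mathbb R$ is an $\alpha\in\mathbb N^{\mathbb N}$ coding rationals $q_n$ with $|q_n-x|\le 2^{-n}$ for all $n$. A function $f:[0,1]\to\mathbb R$ is represented by any total $\Phi:\mathbb N^{\mathbb N}\to\mathbb N$ such that, for every $x\in[0,1]$ and every name $\alpha$ of $x$, the sequence $k\mapsto\Phi(k,\alpha)$ is a name of $f(x)$. (Double) sequences of functions are represented in the same way, with the indices as extra arguments. $C_f$ is the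 set of points of $[0,1]$ at which $f$ is continuous (as a function on $[0,1]$). A modulus of continuity of $f$ is a map $F:\mathbb R\times\mathbb N\to\mathbb N$ such that for all $k\in\mathbb N$, $x\in C_f$, $y\in[0,1]$, $$|x-y|<2^{-F(x,k)}\ \rightarrow\ |f(x)-f(y)|<2^{-k}.$$ "Given $f$ with its representation" means that the algorithm receives as type-2 inputs a representation of $f$ and a representation of a sequence $(f_n)$ of continuous functions on $[0,1]$ with $f(x)=\lim_n f_n(x)$ for all $x\in[0,1]$ (Baire 1), respectively of a double sequence $(f_{n,m})$ of continuous functions on $[0,1]$ with $f(x)=\lim_n\lim_m f_{n,m}(x)$ for all $x\in[0,1]$ (effectively Baire 2). **Theorem.** Each of the following is witnessed by a single index $e$, independent of $f$ and of all other inputs. (a) For Baire 1 $f:[0,1]\to[0,1]$ given with its representation and $p\le q$ in $\mathbb Q\cap[0,1]$, (a name of) the supremum $\sup_{x\in[p,q]}f(x)$ is computable in $\exists^2$. (b) For Baire 1 $f:[0,1]\to\mathbb R$ given with its representation and (a name of) $x\in[0,1]$, $\exists^2$ decides whether $x\in C_f$ (output $1$ if so, $0$ if not). (c) For Baire 1 $f:[0,1]\to\mathbb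 R$ given with its representation, $\exists^2$ computes a modulus of continuity $F$: the value $F(x,k)$ is computed from $k$ and any name of $x\in\mathbb R$, and it does not depend on the name. (d) For effectively Baire 2 $f:[0,1]\to[0,1]$ given with its representation and $p\le q$ in $\mathbb Q\cap[0,1]$, (a name of) the supremum $\sup_{x\in[p,q]}f(x)$ is computable in $\mathsf S^2$. (e) For effectively Baire 2 $f:[0,1]\to[0,1]$ given with its representation and (a name of) $x\in[0,1]$, $\mathsf S^2$ decides whether $x\in C_f$. (f) For effectively Baire 2 $f:[0,1]\to\mathbb R$ given with its representation, $\mathsf S^2$ computes a modulus of continuity, in the same sense as in (c). -/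

import Mathlib

open Filter Topology

namespace Kleene

/-! ### Kleene's higher-order computability (S1-S9) over the pure finite types -/

/-- The pure (full set-theoretic) types: `PureType 0 = ℕ` and `PureType (j+1)` is the set of
all total functionals `PureType j → ℕ`. -/
@[reducible] def PureType : ℕ → Type
  | 0 => ℕ
  | j + 1 => PureType j → ℕ

/-- An argument of a computation: an object of some pure finite type. -/
abbrev Arg : Type := Σ j : ℕ, PureType j

/-- A natural number as an argument of type 0. -/
abbrev arg0 (n : ℕ) : Arg := ⟨0, n⟩

/-- An element of Baire space as an argument of type 1. -/
abbrev arg1 (α : ℕ → ℕ) : Arg := ⟨1, α⟩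

/-- A functional on Baire space as an argument of type 2. -/
abbrev arg2 (F : (ℕ → ℕ) → ℕ) : Arg := ⟨2, F⟩

/-- `Computes e l v` is Kleene's relation `{e}(l) = v`: the computation with index `e` and list
of arguments `l` terminates with value `v`. It is the least relation closed under the schemes
S1-S9. An index is a natural number `⟨i, …⟩`, coded by the pairing function, where `i` is the
number of the scheme. -/
inductive Computes : ℕ → List Arg → ℕ → Prop
  /-- S1, successor: `{⟨1, 0⟩}(n, l) = n + 1`. -/
  | s1 (n : ℕ) (l : List Arg) : Computes (Nat.pair 1 0) (arg0 n :: l) (n + 1)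
  /-- S2, constants: `{⟨2, q⟩}(l) = q`. -/
  | s2 (q : ℕ) (l : List Arg) : Computes (Nat.pair 2 q) l q
  /-- S3, projection: `{⟨3, 0⟩}(n, l) = n`. -/
  | s3 (n : ℕ) (l : List Arg) : Computes (Nat.pair 3 0) (arg0 n :: l) n
  /-- S4, composition: `{⟨4, d, e⟩}(l) = {d}({e}(l), l)`. -/
  | s4 {d e : ℕ} {l : List Arg} {u v : ℕ} (he : Computes e l u)
      (hd : Computes d (arg0 u :: l) v) : Computes (Nat.pair 4 (Nat.pair d e)) l v
  /-- S5, primitive recursion, base case: `{⟨5, d, e⟩}(0, l) = {d}(l)`. -/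
  | s5_zero {d e : ℕ} {l : List Arg} {v : ℕ} (hd : Computes d l v) :
      Computes (Nat.pair 5 (Nat.pair d e)) (arg0 0 :: l) v
  /-- S5, primitive recursion, step:
  `{⟨5, d, e⟩}(n + 1, l) = {e}(n, {⟨5, d, e⟩}(n, l), l)`. -/
  | s5_succ {d e : ℕ} {n : ℕ} {l : List Arg} {u v : ℕ}
      (hu : Computes (Nat.pair 5 (Nat.pair d e)) (arg0 n :: l) u)
      (he : Computes e (arg0 n :: arg0 u :: l) v) :
      Computes (Nat.pair 5 (Nat.pair d e)) (arg0 (n + 1) :: l) v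
  /-- S6, permutation of arguments: `{⟨6, i, e⟩}(l)` is `{e}(l')`, where `l'` arises from `l` by
  moving the argument in position `i` (counted from 0) to the front. -/
  | s6 {e : ℕ} {l₁ l₂ : List Arg} {a : Arg} {v : ℕ} (he : Computes e (a :: (l₁ ++ l₂)) v) :
      Computes (Nat.pair 6 (Nat.pair l₁.length e)) (l₁ ++ a :: l₂) v
  /-- S7, application of an argument of type 1: `{⟨7, 0⟩}(n, α, l) = α(n)`. -/
  | s7 (n : ℕ) (α : ℕ → ℕ) (l : List Arg) :
      Computes (Nat.pair 7 0) (arg0 n :: arg1 α :: l) (α n)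
  /-- S8, application of an argument `F` of type `j + 2`:
  `{⟨8, d⟩}(F, l) = F(λ β. {d}(β, F, l))`, where `β` ranges over all objects of type `j` and
  `{d}(β, F, l)` has to be defined for each of them. -/
  | s8 {d j : ℕ} {F : PureType (j + 2)} {l : List Arg} {γ : PureType (j + 1)}
      (hd : ∀ β : PureType j, Computes d (⟨j, β⟩ :: ⟨j + 2, F⟩ :: l) (γ β)) :
      Computes (Nat.pair 8 d) (⟨j + 2, F⟩ :: l) (F γ)
  /-- S9, enumeration: `{⟨9, m⟩}(a, l₁, l₂) = {a}(l₁)`, where `l₁` has length `m`. -/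
  | s9 {a : ℕ} {l₁ l₂ : List Arg} {v : ℕ} (ha : Computes a l₁ v) :
      Computes (Nat.pair 9 l₁.length) (arg0 a :: (l₁ ++ l₂)) v

/-- Computations are deterministic, so that `{e}(l)` is a partial function. -/
theorem Computes.unique {e : ℕ} {l : List Arg} {v w : ℕ} (hv : Computes e l v)
    (hw : Computes e l w) : v = w := by
  induction hv generalizing w with
  | s1 n l =>
    generalize hi : Nat.pair 1 0 = i at hw
    generalize hl : arg0 n :: l = l' at hw
    cases hw <;> simp_all [Nat.pair_eq_pair]
  | s2 q l =>
    generalize hi : Nat.pair 2 q = i at hw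
    cases hw <;> simp_all [Nat.pair_eq_pair]
  | s3 n l =>
    generalize hi : Nat.pair 3 0 = i at hw
    generalize hl : arg0 n :: l = l' at hw
    cases hw <;> simp_all [Nat.pair_eq_pair]
  | @s4 d e l u v _ _ ihe ihd =>
    generalize hi : Nat.pair 4 (Nat.pair d e) = i at hw
    cases hw with
    | s4 he' hd' =>
      simp only [Nat.pair_eq_pair, true_and] at hi
      obtain ⟨rfl, rfl⟩ := hi
      obtain rfl := ihe he'
      exact ihd hd'
    | _ => simp_all [Nat.pair_eq_pair]
  | @s5_zero d e l v _ ihd =>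
    generalize hi : Nat.pair 5 (Nat.pair d e) = i at hw
    generalize hl : arg0 0 :: l = l' at hw
    cases hw with
    | s5_zero hd' =>
      simp only [Nat.pair_eq_pair, true_and] at hi
      obtain ⟨rfl, rfl⟩ := hi
      simp only [List.cons.injEq, true_and] at hl
      subst hl
      exact ihd hd'
    | _ => simp_all [Nat.pair_eq_pair]
  | @s5_succ d e n l u v _ _ ihu ihe =>
    generalize hi : Nat.pair 5 (Nat.pair d e) = i at hw
    generalize hl : arg0 (n + 1) :: l = l' at hw
    cases hw with
    | s5_succ hu' he' =>
      simp only [Nat.pair_eq_pair, true_and] at hi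
      obtain ⟨rfl, rfl⟩ := hi
      simp only [List.cons.injEq, Sigma.mk.injEq, heq_eq_eq, true_and, Nat.add_right_cancel_iff]
        at hl
      obtain ⟨rfl, rfl⟩ := hl
      obtain rfl := ihu hu'
      exact ihe he'
    | _ => simp_all [Nat.pair_eq_pair]
  | @s6 e l₁ l₂ a v _ ih =>
    generalize hi : Nat.pair 6 (Nat.pair l₁.length e) = i at hw
    generalize hl : l₁ ++ a :: l₂ = l' at hw
    cases hw with
    | s6 he' =>
      simp only [Nat.pair_eq_pair, true_and] at hi
      obtain ⟨h1, rfl⟩ := hi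
      obtain ⟨rfl, h2⟩ := List.append_inj hl h1
      simp only [List.cons.injEq] at h2
      obtain ⟨rfl, rfl⟩ := h2
      exact ih he'
    | _ => simp_all [Nat.pair_eq_pair]
  | s7 n α l =>
    generalize hi : Nat.pair 7 0 = i at hw
    generalize hl : arg0 n :: arg1 α :: l = l' at hw
    cases hw <;> simp_all [Nat.pair_eq_pair]
  | @s8 d j F l γ _ ih =>
    generalize hi : Nat.pair 8 d = i at hw
    generalize hl : (⟨j + 2, F⟩ : Arg) :: l = l' at hw
    cases hw with
    | @s8 d' j' F' l' γ' hd' =>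
      simp only [Nat.pair_eq_pair, true_and] at hi
      subst hi
      simp only [List.cons.injEq, Sigma.mk.injEq, Nat.add_right_cancel_iff] at hl
      obtain ⟨⟨rfl, hF⟩, rfl⟩ := hl
      obtain rfl := eq_of_heq hF
      exact congrArg F (funext fun β => ih β (hd' β))
    | _ => simp_all [Nat.pair_eq_pair]
  | @s9 a l₁ l₂ v _ ih =>
    generalize hi : Nat.pair 9 l₁.length = i at hw
    generalize hl : arg0 a :: (l₁ ++ l₂) = l' at hw
    cases hw with
    | s9 ha' =>
      simp only [Nat.pair_eq_pair, true_and] at hi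
      simp only [List.cons.injEq, Sigma.mk.injEq, heq_eq_eq, true_and] at hl
      obtain ⟨rfl, h2⟩ := hl
      obtain ⟨rfl, -⟩ := List.append_inj h2 hi
      exact ih ha'
    | _ => simp_all [Nat.pair_eq_pair]

/-! ### The oracles -/

open Classical in
/-- Kleene's quantifier `∃²`: `∃²(f) = 0` if `f` has a zero, and `∃²(f) = 1` otherwise. -/
noncomputable def exists2 (f : ℕ → ℕ) : ℕ := if ∃ n, f n = 0 then 0 else 1

/-- The code of the finite sequence `⟨g 0, …, g (n - 1)⟩`, with the coding of lists given by
`code [] = 0` and `code (a :: l) = ⟨a, code l⟩ + 1`. -/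
def initSeg (g : ℕ → ℕ) (n : ℕ) : ℕ := Encodable.encode ((List.range n).map g)

open Classical in
/-- The Suslin functional `S²`: `S²(f) = 0` if there is `g : ℕ → ℕ` such that `f` vanishes on
(the codes of) all initial segments of `g`, and `S²(f) = 1` otherwise. -/
noncomputable def suslin2 (f : ℕ → ℕ) : ℕ :=
  if ∃ g : ℕ → ℕ, ∀ n, f (initSeg g n) = 0 then 0 else 1

/-! ### Rationals, reals and functions on the unit interval as inputs and outputs -/

/-- The rational number with code `⟨⟨a, b⟩, c⟩`, namely `(a - b) / (c + 1)`. Every rational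
number has a code. -/
def ratOf (n : ℕ) : ℚ :=
  ((n.unpair.1.unpair.1 : ℚ) - (n.unpair.1.unpair.2 : ℚ)) / ((n.unpair.2 : ℚ) + 1)

/-- `α` is a name of the real `x`: it codes a sequence of rationals that converges to `x` with
error at most `1 / 2 ^ n` at stage `n`. -/
def IsName (α : ℕ → ℕ) (x : ℝ) : Prop := ∀ n : ℕ, |(ratOf (α n) : ℝ) - x| ≤ 1 / 2 ^ n

/-- The sequence `n, α 0, α 1, …`. -/
def prepend (n : ℕ) (α : ℕ → ℕ) : ℕ → ℕ
  | 0 => n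
  | i + 1 => α i

/-- The type-2 object `Φ` represents `f : [0,1] → ℝ`: the operator `α ↦ (k ↦ Φ (k, α))` on Baire
space sends every name of a point `x` to a name of `f x`. -/
def RepresentsFun (Φ : (ℕ → ℕ) → ℕ) (f : unitInterval → ℝ) : Prop :=
  ∀ (x : unitInterval) (α : ℕ → ℕ), IsName α x → IsName (fun k => Φ (prepend k α)) (f x)

/-- `G` represents the sequence `(g n)`: for each `n`, `G (n, ·)` represents `g n`. -/
def RepresentsSeq (G : (ℕ → ℕ) → ℕ) (g : ℕ → unitInterval → ℝ) : Prop :=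
  ∀ n : ℕ, RepresentsFun (fun β => G (prepend n β)) (g n)

/-- `G` represents the double sequence `(g n m)`: for each `n`, `G (n, ·)` represents the sequence
`(g n m)` in `m`. -/
def RepresentsDoubleSeq (G : (ℕ → ℕ) → ℕ) (g : ℕ → ℕ → unitInterval → ℝ) : Prop :=
  ∀ n : ℕ, RepresentsSeq (fun β => G (prepend n β)) (g n)

/-! ### Baire 1 and effectively Baire 2 functions -/

/-- `f` is Baire 1, as the pointwise limit of the sequence `g` of continuous functions. -/
def IsBaireOneRep (g : ℕ → unitInterval → ℝ) (f : unitInterval → ℝ) : Prop :=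
  (∀ n, Continuous (g n)) ∧ ∀ x, Tendsto (fun n => g n x) atTop (𝓝 (f x))

/-- `f` is effectively Baire 2, as the pointwise repeated limit (limit in `n` of the limit in `m`)
of the double sequence `g` of continuous functions. -/
def IsEffBaireTwoRep (g : ℕ → ℕ → unitInterval → ℝ) (f : unitInterval → ℝ) : Prop :=
  (∀ n m, Continuous (g n m)) ∧
    ∃ h : ℕ → unitInterval → ℝ,
      (∀ n x, Tendsto (fun m => g n m x) atTop (𝓝 (h n x))) ∧
        ∀ x, Tendsto (fun n => h n x) atTop (𝓝 (f x))

/-! ### The three tasks, for an index `e` and a list `l` of type-2 arguments (the representations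
of the function `f` and the oracle) -/

/-- The index `e` computes the suprema of `f` on the rational intervals: for (codes of) rationals
`0 ≤ p ≤ q ≤ 1`, the map `k ↦ {e}(k, p, q, l)` is total and a name of `sup_{x ∈ [p, q]} f x`. -/
def ComputesSup (e : ℕ) (l : List Arg) (f : unitInterval → ℝ) : Prop :=
  ∀ p q : ℕ, 0 ≤ ratOf p → ratOf p ≤ ratOf q → ratOf q ≤ 1 →
    ∃ (s : ℝ) (γ : ℕ → ℕ),
      IsLUB (f '' {x : unitInterval | (ratOf p : ℝ) ≤ x ∧ (x : ℝ) ≤ ratOf q}) s ∧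
        IsName γ s ∧ ∀ k : ℕ, Computes e (arg0 k :: arg0 p :: arg0 q :: l) (γ k)

/-- The index `e` decides membership in the set of continuity points of `f`: for each name `α` of
a point `x` of `[0,1]`, `{e}(α, l)` is `1` if `f` is continuous at `x`, and `0` otherwise. -/
def DecidesContinuity (e : ℕ) (l : List Arg) (f : unitInterval → ℝ) : Prop :=
  ∀ (x : unitInterval) (α : ℕ → ℕ), IsName α x →
    (ContinuousAt f x → Computes e (arg1 α :: l) 1) ∧
      (¬ ContinuousAt f x → Computes e (arg1 α :: l) 0)

/-- `F` is a modulus of continuity of `f` (at the points where `f` is continuous). -/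
def IsModulusOfContinuity (F : ℝ → ℕ → ℕ) (f : unitInterval → ℝ) : Prop :=
  ∀ (k : ℕ) (x : unitInterval), ContinuousAt f x →
    ∀ y : unitInterval, |(x : ℝ) - y| < 1 / 2 ^ F x k → |f x - f y| < 1 / 2 ^ k

/-- The index `e` computes a modulus of continuity `F : ℝ × ℕ → ℕ` of `f`: for each name `α` of a
real `x`, `{e}(k, α, l) = F x k`. The value depends on `x` and not on the name `α`. -/
def ComputesModulus (e : ℕ) (l : List Arg) (f : unitInterval → ℝ) : Prop :=
  ∃ F : ℝ → ℕ → ℕ, IsModulusOfContinuity F f ∧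
    ∀ (x : ℝ) (α : ℕ → ℕ), IsName α x → ∀ k : ℕ, Computes e (arg0 k :: arg1 α :: l) (F x k)

end Kleene

/-!
The proof reduces the six claims to one decision problem: given rationals `p`, `q`, `c`, does `f`
take a value above `c` on `[p, q]`? Given an answer for `f`, the supremum is obtained by searching
for the least `j` with `sup f ≤ j / 2 ^ k`. Given answers for `f` and `-f`, one can decide whether
the values of `f` on a rational interval stay within `1 / 2 ^ (k + 2)` of a rational `r`
(`VariesLittle`). Continuity at `x` says that for each `k` this happens on a neighbourhood of `x`,
and the least possible `m` such that it happens on an interval around the `1 / 2 ^ m`-neighbourhood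
of `x` is a modulus of continuity. The real `x` enters only through strict comparisons with
rationals, and so the choice of its name does not matter.

If `f` is the limit of continuous functions `g n`, then `c < f x` means that there is `N` with
`c + 1 / 2 ^ N ≤ g n x` for all `n ≥ N`. For fixed `N` these are closed conditions on `x`, and by
compactness they have a common solution in `[p, q]` if and only if any finitely many of them have
approximate rational solutions (`exists_forall_le_iff`). Thus the decision problem only involves
quantifiers over natural numbers and the values of `g n` at rationals, and `∃²` solves it. For a
repeated limit of continuous functions `g n m`, there is in addition a function `M` such that the
conditions are required for `n ≥ N` and `m ≥ M n`. By the same compactness argument the problem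
takes the form "there is `M : ℕ → ℕ` such that all initial segments of `M` have a property that
`∃²` decides", which is solved by `S²`.

On the side of computability, `UniformlyComputable` collects the families of total functions that
are computed by a single index from the given arguments. It contains the primitive recursive
functions, and it is closed under composition, application of the arguments of type 2, and
unbounded search (`UniformlyComputable.find`, which uses S9 with self-application). The predicates
with computable characteristic functions are then closed under number quantifiers if one of the
oracles is available (`DecidesQuantifier`).
-/

namespace Kleene

open Encodable

/-! ### Rearranging and substituting arguments -/

/-- An index that moves a block of `m` arguments, standing behind `s` others, to the front and
then continues with `e`; it is an iteration of S6. -/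
def rotIndex (s m e : ℕ) : ℕ := (fun d => Nat.pair 6 (Nat.pair (s + m - 1) d))^[m] e

theorem Computes.rot {s m e r : ℕ} {v w l : List Arg} (hw : w.length = s) (hv : v.length = m)
    (h : Computes e (v ++ (w ++ l)) r) : Computes (rotIndex s m e) (w ++ (v ++ l)) r := by
  -- the invariant: after some moves, a final segment `y` of `v = x ++ y` stands in front of `w`
  have key : ∀ x y : List Arg, x.length + y.length = m → Computes e (x ++ y ++ (w ++ l)) r →
      Computes ((fun d => Nat.pair 6 (Nat.pair (s + m - 1) d))^[x.length] e)
        (y ++ w ++ (x ++ l)) r := by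
    intro x
    induction x using List.reverseRecOn with
    | nil => intro y _ h; simpa using h
    | append_singleton x b ih =>
      intro y hm h
      rw [List.length_append, List.length_singleton, Function.iterate_succ_apply']
      have hlen : s + m - 1 = (y ++ w ++ x).length := by
        simp at hm ⊢; omega
      have := ih (b :: y) (by simp at hm ⊢; omega) (by simpa using h)
      rw [hlen] at this ⊢
      simpa using Computes.s6 (l₁ := y ++ w ++ x) (l₂ := l) (a := b) (by simpa using this)
  have := key v [] (by simpa using hv) (by simpa using h)
  simpa [rotIndex, hv] using this

/-- A vector of natural numbers as a list of arguments of type 0. -/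
def args {n : ℕ} (v : List.Vector ℕ n) : List Arg := v.toList.map arg0

@[simp] theorem length_args {n : ℕ} (v : List.Vector ℕ n) : (args v).length = n := by
  simp [args]

@[simp] theorem args_nil : args (List.Vector.nil : List.Vector ℕ 0) = [] := rfl

@[simp] theorem args_cons {n : ℕ} (a : ℕ) (v : List.Vector ℕ n) :
    args (a ::ᵥ v) = arg0 a :: args v := by
  simp [args]

/-- The function `f` of number arguments is computed by an index that ignores any further
arguments. -/
def IsIndexed {n : ℕ} (f : List.Vector ℕ n → ℕ) : Prop :=
  ∃ e, ∀ v l, Computes e (args v ++ l) (f v)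

/-- Composition: the values of the functions `g i` are put in front of the arguments by S4, from the
last to the first. The values that are already there are moved behind `v` when the next one is
computed. -/
theorem exists_push {m : ℕ} {n : ℕ} (g : Fin n → List.Vector ℕ m → ℕ) (hg : ∀ i, IsIndexed (g i))
    (e : ℕ) : ∃ e', ∀ (v : List.Vector ℕ m) l r,
      Computes e (args (List.Vector.ofFn fun i => g i v) ++ (args v ++ l)) r →
        Computes e' (args v ++ l) r := by
  induction n generalizing e with
  | zero => exact ⟨e, fun v l r h => by simpa [List.Vector.ofFn] using h⟩
  | succ n ih =>
    obtain ⟨d, hd⟩ := hg 0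
    obtain ⟨e', he'⟩ := ih (fun i => g i.succ) (fun i => hg _)
      (Nat.pair 4 (Nat.pair e (rotIndex n m d)))
    refine ⟨e', fun v l r h => he' v l r ?_⟩
    refine Computes.s4 (Computes.rot (by simp) (by simp) (hd v _)) ?_
    simpa [List.Vector.ofFn] using h

theorem IsIndexed.of_primrec' {n : ℕ} {f : List.Vector ℕ n → ℕ} (hf : Nat.Primrec' f) :
    IsIndexed f := by
  induction hf with
  | zero => exact ⟨Nat.pair 2 0, fun v l => Computes.s2 0 _⟩
  | succ =>
    refine ⟨Nat.pair 1 0, fun v l => ?_⟩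
    rw [← v.cons_head_tail, args_cons]
    exact Computes.s1 _ _
  | @get n i =>
    refine ⟨Nat.pair 6 (Nat.pair i (Nat.pair 3 0)), fun v l => ?_⟩
    have h1 : args v = (args v).take i ++ arg0 (v.get i) :: (args v).drop (i + 1) := by
      have : (args v)[(i : ℕ)]'(by simp) = arg0 (v.get i) := by
        simp [args, List.Vector.get_eq_get_toList]
      rw [← this, List.getElem_cons_drop, List.take_append_drop]
    have h2 : ((args v).take i).length = i := by simp [i.2.le]
    have := Computes.s6 (l₁ := (args v).take i) (l₂ := (args v).drop (i + 1) ++ l)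
      (Computes.s3 (v.get i) _)
    rw [h2] at this
    rw [h1]
    simpa using this
  | @comp m n f g _ _ ihf ihg =>
    obtain ⟨e, he⟩ := ihf
    obtain ⟨e', he'⟩ := exists_push g ihg e
    exact ⟨e', fun v l => he' v l _ (he _ _)⟩
  | @prec n f g _ _ ihf ihg =>
    obtain ⟨d, hd⟩ := ihf
    obtain ⟨e, he⟩ := ihg
    refine ⟨Nat.pair 5 (Nat.pair d e), fun v l => ?_⟩
    rw [← v.cons_head_tail]
    generalize v.head = a
    generalize v.tail = w
    simp only [List.Vector.head_cons, List.Vector.tail_cons, args_cons]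
    induction a with
    | zero => exact Computes.s5_zero (hd w l)
    | succ a ih => exact Computes.s5_succ ih (by simpa using he (a ::ᵥ _ ::ᵥ w) l)

theorem IsIndexed.of_primrec {n : ℕ} {f : List.Vector ℕ n → ℕ} (hf : Primrec f) : IsIndexed f :=
  .of_primrec' (.of_prim hf)

/-- Substitution of primitive recursive functions for the number arguments. The number arguments
`v` are replaced by `g v`, and the `t` arguments behind `v` are kept in place. -/
theorem exists_subst {m n : ℕ} {g : List.Vector ℕ m → List.Vector ℕ n} (hg : Primrec g)
    (t e : ℕ) : ∃ e', ∀ (v : List.Vector ℕ m) (o l : List Arg) (r : ℕ), o.length = t →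
      Computes e (args (g v) ++ (o ++ (args v ++ l))) r → Computes e' (args v ++ (o ++ l)) r := by
  obtain ⟨e', he'⟩ := exists_push (fun i v => (g v).get i)
    (fun i => .of_primrec (Primrec.vector_get.comp hg (.const i)))
    (rotIndex (n + m) t (rotIndex t n e))
  refine ⟨e', fun v o l r ho h => he' v (o ++ l) r ?_⟩
  rw [List.Vector.ofFn_get]
  have h1 : Computes (rotIndex t n e) (o ++ ((args (g v) ++ args v) ++ l)) r := by
    simpa using Computes.rot ho (length_args _) h
  simpa using Computes.rot (by simp) ho h1

/-! ### Uniformly computable functions -/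

section

variable {ι X Y Z : Type*} [Primcodable X] [Primcodable Y] [Primcodable Z] {t : ℕ}
  {O : ι → List.Vector Arg t}

/-- The family of total functions `f i : X → Y` is computed, uniformly in `i`, by one index with
the arguments `O i`. Elements of `X` and `Y` are coded by natural numbers. The index has to ignore
any further arguments, which makes the notion stable under substitution. -/
def UniformlyComputable (O : ι → List.Vector Arg t) (f : ι → X → Y) : Prop :=
  ∃ e, ∀ i x l, Computes e (arg0 (encode x) :: ((O i).toList ++ l)) (encode (f i x))

/-- The form of `exists_subst` in which the arguments that stay in place are the `O i`. -/
theorem exists_subst_oracle {m n : ℕ} (O : ι → List.Vector Arg t)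
    {g : List.Vector ℕ m → List.Vector ℕ n} (hg : Primrec g) (e : ℕ) :
    ∃ e', ∀ (i : ι) (v : List.Vector ℕ m) (l : List Arg) (r : ℕ),
      Computes e (args (g v) ++ ((O i).toList ++ (args v ++ l))) r →
        Computes e' (args v ++ ((O i).toList ++ l)) r := by
  obtain ⟨e', he'⟩ := exists_subst hg t e
  exact ⟨e', fun i v l r h => he' v _ l r (by simp) h⟩

theorem primrec_get {n : ℕ} (k : Fin n) : Primrec fun v : List.Vector ℕ n => v.get k :=
  Primrec.vector_get.comp .id (.const k)

theorem primrec_vector_singleton {n : ℕ} {f : List.Vector ℕ n → ℕ} (hf : Primrec f) :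
    Primrec fun v => (f v ::ᵥ List.Vector.nil : List.Vector ℕ 1) :=
  Primrec.vector_cons.comp hf (.const _)

@[simp] theorem get_one_cons {n : ℕ} (a : ℕ) (v : List.Vector ℕ (n + 1)) :
    (a ::ᵥ v).get 1 = v.get 0 := rfl

@[simp] theorem get_two_cons {n : ℕ} (a : ℕ) (v : List.Vector ℕ (n + 2)) :
    (a ::ᵥ v).get 2 = v.get 1 := rfl

@[simp] theorem get_three_cons {n : ℕ} (a : ℕ) (v : List.Vector ℕ (n + 3)) :
    (a ::ᵥ v).get 3 = v.get 2 := rfl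

@[simp] theorem get_four_cons {n : ℕ} (a : ℕ) (v : List.Vector ℕ (n + 4)) :
    (a ::ᵥ v).get 4 = v.get 3 := rfl

theorem toList_eq_take_append_get_cons_drop (v : List.Vector Arg t) (k : Fin t) :
    v.toList = v.toList.take k ++ v.get k :: v.toList.drop (k + 1) := by
  have : v.toList[(k : ℕ)]'(by simp) = v.get k := by
    simp [List.Vector.get_eq_get_toList]
  rw [← this, List.getElem_cons_drop, List.take_append_drop]

namespace UniformlyComputable

theorem of_primrec {f : X → Y} (hf : Primrec f) : UniformlyComputable O fun _ => f := by
  have h1 : Primrec fun v : List.Vector ℕ 1 =>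
      ((decode (α := X) v.head).map fun x => encode (f x)).getD 0 :=
    Primrec.option_getD.comp (Primrec.option_map (Primrec.decode.comp .vector_head)
      ((Primrec.encode.comp (hf.comp .snd)).to₂)) (.const 0)
  obtain ⟨e, he⟩ := IsIndexed.of_primrec h1
  exact ⟨e, fun i x l => by simpa using he (encode x ::ᵥ .nil) ((O i).toList ++ l)⟩

theorem comp {f : ι → Y → Z} {g : ι → X → Y} (hf : UniformlyComputable O f)
    (hg : UniformlyComputable O g) : UniformlyComputable O fun i x => f i (g i x) := by
  obtain ⟨d, hd⟩ := hf
  obtain ⟨e, he⟩ := hg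
  obtain ⟨d', hd'⟩ := exists_subst_oracle (m := 2) O (primrec_vector_singleton (primrec_get 0)) d
  refine ⟨Nat.pair 4 (Nat.pair d' e), fun i x l => Computes.s4 (he i x l) ?_⟩
  simpa using hd' i (encode (g i x) ::ᵥ encode x ::ᵥ .nil) l _ (by simpa using hd i (g i x) _)

theorem pair {f : ι → X → Y} {g : ι → X → Z} (hf : UniformlyComputable O f)
    (hg : UniformlyComputable O g) : UniformlyComputable O fun i x => (f i x, g i x) := by
  obtain ⟨d, hd⟩ := hf
  obtain ⟨e, he⟩ := hg
  obtain ⟨d', hd'⟩ := exists_subst_oracle (m := 2) O (primrec_vector_singleton (primrec_get 1)) d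
  obtain ⟨c, hc⟩ := IsIndexed.of_primrec (n := 2) (f := fun v => Nat.pair (v.get 0) (v.get 1))
    (Primrec₂.natPair.comp (primrec_get 0) (primrec_get 1))
  refine ⟨Nat.pair 4 (Nat.pair (Nat.pair 4 (Nat.pair c d')) e), fun i x l =>
    Computes.s4 (he i x l) (Computes.s4 (u := encode (f i x)) ?_ ?_)⟩
  · simpa using hd' i (encode (g i x) ::ᵥ encode x ::ᵥ .nil) l _ (by simpa using hd i x _)
  · simpa using hc (encode (f i x) ::ᵥ encode (g i x) ::ᵥ .nil)
      (arg0 (encode x) :: ((O i).toList ++ l))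

theorem primrec_comp {f : Y → Z} {g : ι → X → Y} (hf : Primrec f)
    (hg : UniformlyComputable O g) : UniformlyComputable O fun i x => f (g i x) :=
  (of_primrec hf).comp hg

/-- Application of an argument of type 2 to a function that depends on the parameter (S8). -/
theorem apply₂ {F : ι → (ℕ → ℕ) → ℕ} (k : Fin t) (hF : ∀ i, (O i).get k = arg2 (F i))
    {f : ι → X → ℕ → ℕ} (hf : UniformlyComputable O fun i (y : X × ℕ) => f i y.1 y.2) :
    UniformlyComputable O fun i x => F i (f i x) := by
  obtain ⟨d, hd⟩ := hf
  obtain ⟨d', hd'⟩ := exists_subst_oracle (m := 2) O (primrec_vector_singleton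
    (Primrec₂.natPair.comp (primrec_get 1) (primrec_get 0))) d
  refine ⟨Nat.pair 6 (Nat.pair (k + 1) (Nat.pair 8 (Nat.pair 6 (Nat.pair 1
    (rotIndex 1 (k + 2) d'))))), fun i x l => ?_⟩
  have hO := toList_eq_take_append_get_cons_drop (O i) k
  rw [hF] at hO
  have hlen : ((O i).toList.take k).length = k := by simp [k.2.le]
  generalize (O i).toList.take k = o₁ at hO hlen
  generalize (O i).toList.drop (k + 1) = o₂ at hO
  have main : Computes (Nat.pair 8 (Nat.pair 6 (Nat.pair 1 (rotIndex 1 (k + 2) d'))))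
      (arg2 (F i) :: arg0 (encode x) :: (o₁ ++ (o₂ ++ l))) (F i (f i x)) := by
    refine Computes.s8 (j := 0) (F := F i) (γ := f i x) fun n => ?_
    refine Computes.s6 (l₁ := [arg0 n]) (l₂ := arg0 (encode x) :: (o₁ ++ (o₂ ++ l)))
      (a := arg2 (F i)) ?_
    refine Computes.rot (w := [arg2 (F i)]) (v := arg0 n :: arg0 (encode x) :: o₁)
      (l := o₂ ++ l) rfl (by simp [hlen]) ?_
    have := hd' i (n ::ᵥ encode x ::ᵥ .nil) l (f i x n)
      (by simpa using hd i (x, n) (arg0 n :: arg0 (encode x) :: l))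
    simpa [hO] using this
  have h6 := Computes.s6 (l₁ := arg0 (encode x) :: o₁) (l₂ := o₂ ++ l) (a := arg2 (F i))
    (by simpa using main)
  simpa [hO, hlen] using h6

/-- Application of an argument of type 1 (S7). -/
theorem apply₁ {α : ι → ℕ → ℕ} (k : Fin t) (hα : ∀ i, (O i).get k = arg1 (α i)) :
    UniformlyComputable O α := by
  refine ⟨Nat.pair 6 (Nat.pair (k + 1) (Nat.pair 6 (Nat.pair 1 (Nat.pair 7 0)))),
    fun i n l => ?_⟩
  have hO := toList_eq_take_append_get_cons_drop (O i) k
  rw [hα] at hO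
  have hlen : ((O i).toList.take k).length = k := by simp [k.2.le]
  generalize (O i).toList.take k = o₁ at hO hlen
  generalize (O i).toList.drop (k + 1) = o₂ at hO
  have main := Computes.s6 (l₁ := [arg1 (α i)]) (l₂ := o₁ ++ (o₂ ++ l)) (a := arg0 n)
    (Computes.s7 n (α i) _)
  have h6 := Computes.s6 (l₁ := arg0 n :: o₁) (l₂ := o₂ ++ l) (a := arg1 (α i))
    (by simpa using main)
  simpa [hO, hlen] using h6

/-- An additional argument in front can be ignored. -/
theorem cons {κ : Type*} {f : ι → X → Y} (hf : UniformlyComputable O f) (a : κ → Arg) :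
    UniformlyComputable (fun p : ι × κ => a p.2 ::ᵥ O p.1) fun p => f p.1 := by
  obtain ⟨e, he⟩ := hf
  refine ⟨Nat.pair 6 (Nat.pair 1 (rotIndex 1 (t + 1) e)), fun p x l => ?_⟩
  have h := Computes.rot (s := 1) (m := t + 1) (w := [a p.2])
    (v := arg0 (encode x) :: (O p.1).toList) (l := l) rfl (by simp)
    (by simpa using he p.1 x (a p.2 :: l))
  simpa using Computes.s6 (l₁ := [arg0 (encode x)]) (a := a p.2) h

/-- Unbounded search. The index `d` tests `n` and otherwise calls the index given as its first
argument on `n + 1`; it is applied to itself (S9). -/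
theorem find {P : ι → X → ℕ → Prop} [∀ i x, DecidablePred (P i x)]
    (hP : UniformlyComputable O fun i (y : X × ℕ) => if P i y.1 y.2 then 0 else 1)
    (hex : ∀ i x, ∃ n, P i x n) : UniformlyComputable O fun i x => Nat.find (hex i x) := by
  obtain ⟨c, hc⟩ := hP
  -- the test, on the arguments `a, n, x`
  obtain ⟨c', hc'⟩ := exists_subst_oracle (m := 3) O (primrec_vector_singleton
    (Primrec₂.natPair.comp (primrec_get 2) (primrec_get 1))) c
  -- the case that the test succeeds
  obtain ⟨d₀, hd₀⟩ := IsIndexed.of_primrec (primrec_get (n := 3) 1)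
  -- the case that it fails, on the arguments `0, n, a, n, x`
  obtain ⟨d₁, hd₁⟩ := exists_subst_oracle (m := 5) O
    (g := fun v => v.get 2 ::ᵥ v.get 2 ::ᵥ (v.get 3 + 1) ::ᵥ v.get 4 ::ᵥ .nil)
    (Primrec.vector_cons.comp (primrec_get 2) (Primrec.vector_cons.comp (primrec_get 2)
      (Primrec.vector_cons.comp (Primrec.succ.comp (primrec_get 3))
        (primrec_vector_singleton (primrec_get 4))))) (Nat.pair 9 (3 + t))
  set d := Nat.pair 4 (Nat.pair (Nat.pair 5 (Nat.pair d₀ d₁)) c') with hd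
  have step (i : ι) (x : X) (n : ℕ) (l : List Arg) (r : ℕ)
      (hr : if P i x n then r = n else
        Computes d (arg0 d :: arg0 (n + 1) :: arg0 (encode x) :: (O i).toList) r) :
      Computes d (arg0 d :: arg0 n :: arg0 (encode x) :: ((O i).toList ++ l)) r := by
    have htest := hc' i (d ::ᵥ n ::ᵥ encode x ::ᵥ .nil) l _
      (by simpa using hc i (x, n) (arg0 d :: arg0 n :: arg0 (encode x) :: l))
    have hzero : Computes d₀ (arg0 d :: arg0 n :: arg0 (encode x) :: ((O i).toList ++ l)) n := by
      simpa using hd₀ (d ::ᵥ n ::ᵥ encode x ::ᵥ .nil) ((O i).toList ++ l)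
    refine Computes.s4 (by simpa using htest) ?_
    by_cases h : P i x n
    · simp only [h, if_true] at hr ⊢
      exact Computes.s5_zero (hr ▸ hzero)
    · simp only [h, if_false] at hr ⊢
      refine Computes.s5_succ (n := 0) (Computes.s5_zero hzero) ?_
      have h9 := Computes.s9
        (l₂ := arg0 0 :: arg0 n :: arg0 d :: arg0 n :: arg0 (encode x) :: l) hr
      have := hd₁ i (0 ::ᵥ n ::ᵥ d ::ᵥ n ::ᵥ encode x ::ᵥ .nil) l r
        (by simpa [show t + 1 + 1 + 1 = 3 + t by omega] using h9)
      simpa using this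
  have search (i : ι) (x : X) (j n : ℕ) (l : List Arg) (hn : n + j = Nat.find (hex i x)) :
      Computes d (arg0 d :: arg0 n :: arg0 (encode x) :: ((O i).toList ++ l))
        (Nat.find (hex i x)) := by
    induction j generalizing n l with
    | zero =>
      refine step i x n l _ ?_
      rw [add_zero] at hn
      rw [if_pos (hn ▸ Nat.find_spec (hex i x)), hn]
    | succ j ih =>
      refine step i x n l _ ?_
      rw [if_neg (Nat.find_min (hex i x) (by omega))]
      simpa using ih (n + 1) [] (by omega)
  refine ⟨Nat.pair 4 (Nat.pair (Nat.pair 4 (Nat.pair d (Nat.pair 2 d))) (Nat.pair 2 0)),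
    fun i x l => ?_⟩
  exact Computes.s4 (Computes.s2 0 _) (Computes.s4 (Computes.s2 d _)
    (search i x _ 0 l (Nat.zero_add _)))

end UniformlyComputable

/-! ### Uniformly decidable predicates and quantifiers -/

open Classical in
/-- The family of predicates `P i` is decided, uniformly in `i`, by one index with the arguments
`O i`. As in the definition of `∃²`, the value `0` stands for truth and `1` for falsity. -/
def UniformlyDecidable (O : ι → List.Vector Arg t) (P : ι → X → Prop) : Prop :=
  UniformlyComputable O fun i x => if P i x then 0 else 1

namespace UniformlyDecidable

theorem of_primrec {p : X → Prop} (hp : PrimrecPred p) : UniformlyDecidable O fun _ => p := by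
  classical
  unfold UniformlyDecidable
  convert UniformlyComputable.of_primrec (O := O) (Primrec.ite hp (.const 0) (.const 1))

theorem comp {P : ι → Y → Prop} (hP : UniformlyDecidable O P) {g : ι → X → Y}
    (hg : UniformlyComputable O g) : UniformlyDecidable O fun i x => P i (g i x) :=
  UniformlyComputable.comp hP hg

theorem comp_primrec {P : ι → Y → Prop} (hP : UniformlyDecidable O P) {g : X → Y}
    (hg : Primrec g) : UniformlyDecidable O fun i x => P i (g x) :=
  hP.comp (.of_primrec hg)

theorem of_iff {P Q : ι → X → Prop} (hP : UniformlyDecidable O P) (h : ∀ i x, P i x ↔ Q i x) :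
    UniformlyDecidable O Q := by
  obtain rfl : P = Q := by ext i x; exact h i x
  exact hP

theorem not {P : ι → X → Prop} (hP : UniformlyDecidable O P) :
    UniformlyDecidable O fun i x => ¬ P i x := by
  have := UniformlyComputable.primrec_comp
    (Primrec.nat_sub.comp (.const 1) .id) hP
  unfold UniformlyDecidable
  convert this using 3 with i x
  by_cases h : P i x <;> simp [h]

theorem and {P Q : ι → X → Prop} (hP : UniformlyDecidable O P) (hQ : UniformlyDecidable O Q) :
    UniformlyDecidable O fun i x => P i x ∧ Q i x := by
  have := UniformlyComputable.primrec_comp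
    (Primrec.nat_max.comp .fst .snd) (UniformlyComputable.pair hP hQ)
  unfold UniformlyDecidable
  convert this using 3 with i x
  by_cases h : P i x <;> by_cases h' : Q i x <;> simp [h, h']

theorem imp {P Q : ι → X → Prop} (hP : UniformlyDecidable O P) (hQ : UniformlyDecidable O Q) :
    UniformlyDecidable O fun i x => P i x → Q i x :=
  (hP.and hQ.not).not.of_iff fun i x => by tauto

theorem or {P Q : ι → X → Prop} (hP : UniformlyDecidable O P) (hQ : UniformlyDecidable O Q) :
    UniformlyDecidable O fun i x => P i x ∨ Q i x :=
  (hP.not.imp hQ).of_iff fun i x => by tauto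

theorem cons {κ : Type*} {P : ι → X → Prop} (hP : UniformlyDecidable O P) (a : κ → Arg) :
    UniformlyDecidable (fun p : ι × κ => a p.2 ::ᵥ O p.1) fun p => P p.1 :=
  UniformlyComputable.cons hP a

end UniformlyDecidable

/-- The predicates that are decidable with the arguments `O i` are closed under quantification
over the natural numbers. -/
def DecidesQuantifier (O : ι → List.Vector Arg t) : Prop :=
  ∀ {X : Type} [Primcodable X] {P : ι → X × ℕ → Prop}, UniformlyDecidable O P →
    UniformlyDecidable O fun i x => ∃ n, P i (x, n)

theorem decidesQuantifier_of_exists2 (k : Fin t) (hk : ∀ i, (O i).get k = arg2 exists2) :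
    DecidesQuantifier O := by
  classical
  intro X _ P hP
  have := UniformlyComputable.apply₂ (F := fun _ => exists2) (X := X)
    (f := fun i x n => if P i (x, n) then 0 else 1) k hk hP
  unfold UniformlyDecidable
  convert this using 3 with i x
  simp [exists2]

theorem encode_initSeg (g : ℕ → ℕ) (n : ℕ) :
    Denumerable.ofNat (List ℕ) (initSeg g n) = (List.range n).map g :=
  Denumerable.ofNat_encode _

/-- The Suslin functional decides the quantifier "there is `g : ℕ → ℕ` all of whose initial
segments satisfy `P`". -/
theorem UniformlyDecidable.exists_forall_initSeg (k : Fin t)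
    (hk : ∀ i, (O i).get k = arg2 suslin2) {P : ι → X × List ℕ → Prop}
    (hP : UniformlyDecidable O P) :
    UniformlyDecidable O fun i x => ∃ g : ℕ → ℕ, ∀ n, P i (x, (List.range n).map g) := by
  classical
  have := UniformlyComputable.apply₂ (F := fun _ => suslin2) (X := X)
    (f := fun i x n => if P i (x, Denumerable.ofNat (List ℕ) n) then 0 else 1) k hk
    (hP.comp_primrec (Primrec.fst.pair ((Primrec.ofNat (List ℕ)).comp .snd)))
  unfold UniformlyDecidable
  convert this using 3 with i x
  simp [suslin2, encode_initSeg]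

theorem decidesQuantifier_of_suslin2 (k : Fin t) (hk : ∀ i, (O i).get k = arg2 suslin2) :
    DecidesQuantifier O := by
  intro X _ P hP
  -- `n` is found as the first entry of `g`
  have hQ : UniformlyDecidable O fun i (y : X × List ℕ) => y.2.length ≠ 0 → P i (y.1, y.2.headI) :=
    (UniformlyDecidable.of_primrec (p := fun y : X × List ℕ => y.2.length = 0)
      (Primrec.eq.comp (Primrec.list_length.comp .snd) (.const 0))).not.imp
      (hP.comp_primrec (Primrec.fst.pair (Primrec.list_headI.comp .snd)))
  refine (hQ.exists_forall_initSeg k hk).of_iff fun i x => ⟨?_, ?_⟩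
  · rintro ⟨g, hg⟩
    exact ⟨_, hg 1 (by simp)⟩
  · rintro ⟨n, hn⟩
    refine ⟨fun _ => n, fun m hm => ?_⟩
    cases m with
    | zero => simp at hm
    | succ m => simpa [List.range_succ_eq_map] using hn

namespace DecidesQuantifier

variable {X : Type} [Primcodable X]

theorem all (hO : DecidesQuantifier O) {P : ι → X × ℕ → Prop} (hP : UniformlyDecidable O P) :
    UniformlyDecidable O fun i x => ∀ n, P i (x, n) :=
  (hO hP.not).not.of_iff fun i x => by push Not; rfl

theorem sInf (hO : DecidesQuantifier O) {P : ι → X × ℕ → Prop} (hP : UniformlyDecidable O P) :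
    UniformlyComputable O fun i x => sInf {n | P i (x, n)} := by
  classical
  -- the search also stops if there is nothing to be found
  have hQ : UniformlyDecidable O fun i (y : X × ℕ) => P i y ∨ ¬ ∃ n, P i (y.1, n) :=
    hP.or ((hO hP).comp_primrec (g := fun y : X × ℕ => y.1) .fst).not
  have hex (i : ι) (x : X) : ∃ n, P i (x, n) ∨ ¬ ∃ n, P i (x, n) := by
    by_cases h : ∃ n, P i (x, n)
    · exact h.imp fun n hn => .inl hn
    · exact ⟨0, .inr h⟩
  have hfind := UniformlyComputable.find (P := fun i x n => P i (x, n) ∨ ¬ ∃ n, P i (x, n))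
    (by unfold UniformlyDecidable at hQ; convert hQ) hex
  convert hfind using 3 with i x
  by_cases h : ∃ n, P i (x, n)
  · rw [Nat.sInf_def (s := {n | P i (x, n)}) h]
    simp [h]
  · have h' : {n | P i (x, n)} = ∅ := Set.eq_empty_of_forall_notMem fun n hn => h ⟨n, hn⟩
    rw [h', Nat.sInf_empty, eq_comm, Nat.find_eq_zero]
    exact .inr h

end DecidesQuantifier

end

/-! ### Codes of rational numbers -/

/-- The code of a sum of rationals. -/
def ratAdd (a b : ℕ) : ℕ :=
  Nat.pair
    (Nat.pair (a.unpair.1.unpair.1 * (b.unpair.2 + 1) + b.unpair.1.unpair.1 * (a.unpair.2 + 1))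
      (a.unpair.1.unpair.2 * (b.unpair.2 + 1) + b.unpair.1.unpair.2 * (a.unpair.2 + 1)))
    ((a.unpair.2 + 1) * (b.unpair.2 + 1) - 1)

/-- The code of the opposite of a rational. -/
def ratNeg (a : ℕ) : ℕ :=
  Nat.pair (Nat.pair a.unpair.1.unpair.2 a.unpair.1.unpair.1) a.unpair.2

/-- The code of the rational `j / 2 ^ k`. -/
def dyadic (j k : ℕ) : ℕ := Nat.pair (Nat.pair j 0) (2 ^ k - 1)

theorem ratOf_ratAdd (a b : ℕ) : ratOf (ratAdd a b) = ratOf a + ratOf b := by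
  have h : ((((a.unpair.2 + 1) * (b.unpair.2 + 1) - 1 : ℕ) : ℚ) + 1) =
      (a.unpair.2 + 1) * (b.unpair.2 + 1) := by
    rw [Nat.cast_sub (Nat.mul_pos (by simp) (by simp))]
    push_cast
    ring
  simp only [ratOf, ratAdd, Nat.unpair_pair, h]
  push_cast
  field_simp
  ring

theorem ratOf_ratNeg (a : ℕ) : ratOf (ratNeg a) = -ratOf a := by
  simp only [ratOf, ratNeg, Nat.unpair_pair]
  ring

theorem ratOf_dyadic (j k : ℕ) : ratOf (dyadic j k) = j / 2 ^ k := by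
  simp [ratOf, dyadic, Nat.cast_sub Nat.one_le_two_pow]

theorem exists_ratOf_eq (r : ℚ) : ∃ n, ratOf n = r := by
  refine ⟨Nat.pair (Nat.pair r.num.toNat (-r.num).toNat) (r.den - 1), ?_⟩
  have h1 : (r.num.toNat : ℚ) - ((-r.num).toNat : ℚ) = r.num := by
    exact_mod_cast Int.toNat_sub_toNat_neg r.num
  simp only [ratOf, Nat.unpair_pair, h1]
  rw [Nat.cast_sub r.pos]
  simpa using r.num_div_den

section
variable {X : Type*} [Primcodable X] {f g : X → ℕ}

theorem primrec_ratAdd (hf : Primrec f) (hg : Primrec g) :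
    Primrec fun x => ratAdd (f x) (g x) := by
  have h1 {h : X → ℕ} (hh : Primrec h) : Primrec fun x => (h x).unpair.1 :=
    Primrec.fst.comp (Primrec.unpair.comp hh)
  have h2 {h : X → ℕ} (hh : Primrec h) : Primrec fun x => (h x).unpair.2 :=
    Primrec.snd.comp (Primrec.unpair.comp hh)
  have hm {h k : X → ℕ} (hh : Primrec h) (hk : Primrec k) : Primrec fun x => h x * (k x + 1) :=
    Primrec.nat_mul.comp hh (Primrec.succ.comp hk)
  have hd : Primrec fun x => ((f x).unpair.2 + 1) * ((g x).unpair.2 + 1) - 1 :=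
    Primrec.nat_sub.comp (hm (Primrec.succ.comp (h2 hf)) (h2 hg)) (.const 1)
  exact Primrec₂.natPair.comp (Primrec₂.natPair.comp
    (Primrec.nat_add.comp (hm (h1 (h1 hf)) (h2 hg)) (hm (h1 (h1 hg)) (h2 hf)))
    (Primrec.nat_add.comp (hm (h2 (h1 hf)) (h2 hg)) (hm (h2 (h1 hg)) (h2 hf)))) hd

theorem primrec_ratNeg (hf : Primrec f) : Primrec fun x => ratNeg (f x) := by
  have h := Primrec.unpair.comp (Primrec.fst.comp (Primrec.unpair.comp hf))
  exact Primrec₂.natPair.comp (Primrec₂.natPair.comp (Primrec.snd.comp h) (Primrec.fst.comp h))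
    (Primrec.snd.comp (Primrec.unpair.comp hf))

theorem primrec_dyadic (hf : Primrec f) (hg : Primrec g) :
    Primrec fun x => dyadic (f x) (g x) := by
  have hpow : Primrec₂ fun m n : ℕ => m ^ n := Primrec₂.unpaired'.1 Nat.Primrec.pow
  exact Primrec₂.natPair.comp (Primrec₂.natPair.comp hf (.const 0))
    (Primrec.nat_sub.comp (hpow.comp (.const 2) hg) (.const 1))

theorem primrecPred_ratOf_nonneg (hf : Primrec f) : PrimrecPred fun x => 0 ≤ ratOf (f x) := by
  have h := Primrec.unpair.comp (Primrec.fst.comp (Primrec.unpair.comp hf))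
  refine (Primrec.nat_le.comp (Primrec.snd.comp h) (Primrec.fst.comp h)).of_eq fun x => ?_
  have : (0 : ℚ) < (f x).unpair.2 + 1 := by positivity
  simp [ratOf, div_nonneg_iff, this.le, this.not_ge]

theorem primrecPred_ratOf_le (hf : Primrec f) (hg : Primrec g) :
    PrimrecPred fun x => ratOf (f x) ≤ ratOf (g x) :=
  (primrecPred_ratOf_nonneg (primrec_ratAdd hg (primrec_ratNeg hf))).of_eq fun x => by
    rw [ratOf_ratAdd, ratOf_ratNeg, ← sub_eq_add_neg, sub_nonneg]

end

/-! ### Closed conditions on a point of a rational interval -/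

theorem isName_const {r : ℕ} {x : ℝ} (hx : x = ratOf r) : IsName (fun _ => r) x := by
  intro n
  simp [hx]

/-- A point of a rational interval is approximated by rational points of that interval. -/
theorem exists_ratOf_mem_of_eventually {p q : ℚ} {y : unitInterval} (hp : (p : ℝ) ≤ y)
    (hq : (y : ℝ) ≤ q) {P : unitInterval → Prop} (hP : ∀ᶠ x in 𝓝 y, P x) :
    ∃ (r : ℕ) (x : unitInterval), (x : ℝ) = ratOf r ∧ (p : ℝ) ≤ x ∧ (x : ℝ) ≤ q ∧ P x := by
  by_cases hy : ∃ s : ℚ, (s : ℝ) = y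
  · obtain ⟨s, hs⟩ := hy
    obtain ⟨r, rfl⟩ := exists_ratOf_eq s
    exact ⟨r, y, hs.symm, hp, hq, hP.self_of_nhds⟩
  · have hq' : (y : ℝ) < q := hq.lt_of_ne fun h => hy ⟨q, h.symm⟩
    have h1' : (y : ℝ) < 1 := y.2.2.lt_of_ne fun h => hy ⟨1, by simp [h]⟩
    obtain ⟨ε, hε, hball⟩ := Metric.eventually_nhds_iff.1 hP
    obtain ⟨s, hs, hs'⟩ := exists_rat_btwn (lt_min (lt_add_of_pos_right (y : ℝ) hε)
      (lt_min hq' h1'))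
    obtain ⟨r, rfl⟩ := exists_ratOf_eq s
    rw [lt_min_iff, lt_min_iff] at hs'
    refine ⟨r, ⟨ratOf r, (y.2.1.trans hs.le), hs'.2.2.le⟩, rfl, hp.trans hs.le, hs'.2.1.le,
      hball ?_⟩
    rw [Subtype.dist_eq, Real.dist_eq, abs_lt]
    constructor <;> dsimp only <;> linarith [hs'.1]

/-- A family of closed conditions `c ≤ u j x` has a common solution in a rational interval if and
only if any finitely many of them have approximate rational solutions. This reduces the
existence of a real number to that of natural numbers. The rational `a j L r` stands for the
value of `u j` at `r` with error `1 / 2 ^ L`. -/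
theorem exists_forall_le_iff {u : ℕ → unitInterval → ℝ} (hu : ∀ j, Continuous (u j))
    {a : ℕ → ℕ → ℕ → ℕ} (ha : ∀ j L r (x : unitInterval), (x : ℝ) = ratOf r →
      |(ratOf (a j L r) : ℝ) - u j x| ≤ 1 / 2 ^ L) (J : ℕ → Prop) (p q : ℚ) (c : ℝ) :
    (∃ x : unitInterval, (p : ℝ) ≤ x ∧ (x : ℝ) ≤ q ∧ ∀ j, J j → c ≤ u j x) ↔
      ∀ L, ∃ r, ((0 ≤ ratOf r ∧ ratOf r ≤ 1) ∧ p ≤ ratOf r ∧ ratOf r ≤ q) ∧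
        ∀ j, j < L → J j → c ≤ ratOf (a j L r) + 2 / 2 ^ L := by
  constructor
  · rintro ⟨y, hp, hq, hy⟩ L
    have hev : ∀ᶠ x in 𝓝 y, ∀ j ∈ Finset.range L, u j y - 1 / 2 ^ L < u j x :=
      (Finset.eventually_all _).2 fun j _ =>
        (hu j).continuousAt.eventually (lt_mem_nhds (sub_lt_self _ (by positivity)))
    obtain ⟨r, x, hr, hpx, hxq, hx⟩ := exists_ratOf_mem_of_eventually hp hq hev
    refine ⟨r, ⟨⟨?_, ?_⟩, ?_, ?_⟩, fun j hj hJ => ?_⟩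
    · exact_mod_cast hr ▸ x.2.1
    · exact_mod_cast hr ▸ x.2.2
    · exact_mod_cast hr ▸ hpx
    · exact_mod_cast hr ▸ hxq
    · have h1 := hx j (Finset.mem_range.2 hj)
      have h2 := (abs_le.1 (ha j L r x hr)).1
      have h3 := hy j hJ
      have h4 : (2 : ℝ) / 2 ^ L = 1 / 2 ^ L + 1 / 2 ^ L := by ring
      linarith
  · intro h
    choose r hr hJ using h
    let x : ℕ → unitInterval := fun L =>
      ⟨ratOf (r L), by exact_mod_cast (hr L).1.1, by exact_mod_cast (hr L).1.2⟩
    obtain ⟨y, φ, hφ, hy⟩ := CompactSpace.tendsto_subseq x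
    have hy' : Tendsto (fun k => (x (φ k) : ℝ)) atTop (𝓝 y) :=
      (continuous_subtype_val.tendsto y).comp hy
    refine ⟨y, ge_of_tendsto' hy' fun k => ?_, le_of_tendsto' hy' fun k => ?_, fun j hj => ?_⟩
    · exact Rat.cast_le.2 (hr (φ k)).2.1
    · exact Rat.cast_le.2 (hr (φ k)).2.2
    · have h1 : Tendsto (fun k => u j (x (φ k)) + 3 * (1 / 2) ^ φ k) atTop (𝓝 (u j y + 3 * 0)) :=
        (((hu j).tendsto y).comp hy).add (((tendsto_pow_atTop_nhds_zero_of_lt_one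
          (by norm_num) (by norm_num)).comp hφ.tendsto_atTop).const_mul 3)
      rw [mul_zero, add_zero] at h1
      refine ge_of_tendsto h1 (eventually_atTop.2 ⟨j + 1, fun k hk => ?_⟩)
      have h2 := hJ (φ k) j (lt_of_lt_of_le hk hφ.le_apply) hj
      have h3 := (abs_le.1 (ha j (φ k) (r (φ k)) (x (φ k)) rfl)).2
      have h4 : (2 : ℝ) / 2 ^ φ k = 2 * (1 / 2) ^ φ k := by rw [one_div_pow]; ring
      rw [one_div_pow] at *
      linarith

/-! ### Values of a limit above a bound -/

theorem exists_one_div_two_pow_lt {ε : ℝ} (hε : 0 < ε) : ∃ n : ℕ, 1 / 2 ^ n < ε := by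
  obtain ⟨n, hn⟩ := exists_pow_lt_of_lt_one hε (show (1 / 2 : ℝ) < 1 by norm_num)
  exact ⟨n, by rwa [one_div_pow] at hn⟩

/-- The strict inequality is witnessed by a single number `N`, which serves both as a bound for the
tail of the sequence and as a lower bound `1 / 2 ^ N` for the distance to `c`. -/
theorem lt_lim_iff {u : ℕ → ℝ} {a c : ℝ} (hu : Tendsto u atTop (𝓝 a)) :
    c < a ↔ ∃ N : ℕ, ∀ n, N ≤ n → c + 1 / 2 ^ N ≤ u n := by
  constructor
  · intro h
    obtain ⟨k, hk⟩ := exists_one_div_two_pow_lt (sub_pos.2 h)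
    obtain ⟨N, hN⟩ := eventually_atTop.1 (hu.eventually (lt_mem_nhds (lt_sub_iff_add_lt'.1 hk)))
    refine ⟨max N k, fun n hn => ?_⟩
    have h1 := hN n ((le_max_left _ _).trans hn)
    have h2 : (1 : ℝ) / 2 ^ max N k ≤ 1 / 2 ^ k :=
      one_div_pow_le_one_div_pow_of_le (by norm_num) (le_max_right N k)
    linarith
  · rintro ⟨N, hN⟩
    have h1 := ge_of_tendsto hu (eventually_atTop.2 ⟨N, hN⟩)
    have h2 : (0 : ℝ) < 1 / 2 ^ N := by positivity
    linarith

/-- For a repeated limit, the witness also has a function `M` that bounds the tails of the inner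
sequences. -/
theorem lt_lim_lim_iff {u : ℕ → ℕ → ℝ} {v : ℕ → ℝ} {a c : ℝ}
    (hu : ∀ n, Tendsto (u n) atTop (𝓝 (v n))) (hv : Tendsto v atTop (𝓝 a)) :
    c < a ↔ ∃ (N : ℕ) (M : ℕ → ℕ), ∀ n m, N ≤ n → M n ≤ m → c + 1 / 2 ^ N ≤ u n m := by
  constructor
  · intro h
    obtain ⟨c', hc, hc'⟩ := exists_between h
    obtain ⟨N, hN⟩ := (lt_lim_iff hv).1 hc'
    obtain ⟨k, hk⟩ := exists_one_div_two_pow_lt (sub_pos.2 hc)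
    have hlt (n : ℕ) (hn : max N k ≤ n) : c + 1 / 2 ^ max N k < v n := by
      have h1 := hN n ((le_max_left _ _).trans hn)
      have h2 : (1 : ℝ) / 2 ^ max N k ≤ 1 / 2 ^ k :=
        one_div_pow_le_one_div_pow_of_le (by norm_num) (le_max_right N k)
      have h3 : (0 : ℝ) < 1 / 2 ^ N := by positivity
      linarith
    have hM (n : ℕ) : ∃ M, ∀ m, M ≤ m → max N k ≤ n → c + 1 / 2 ^ max N k ≤ u n m := by
      by_cases hn : max N k ≤ n
      · obtain ⟨M, hM⟩ := eventually_atTop.1 ((hu n).eventually (lt_mem_nhds (hlt n hn)))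
        exact ⟨M, fun m hm _ => (hM m hm).le⟩
      · exact ⟨0, fun m _ h => absurd h hn⟩
    choose M hM using hM
    exact ⟨max N k, M, fun n m hn hm => hM n m hm hn⟩
  · rintro ⟨N, M, h⟩
    exact (lt_lim_iff hv).2 ⟨N, fun n hn =>
      ge_of_tendsto (hu n) (eventually_atTop.2 ⟨M n, fun m hm => h n m hn hm⟩)⟩

/-! ### Deciding whether a value exceeds a rational -/

/-- For codes `y = (p, q, c)` of rationals: `f` takes a value above `c` on `[p, q]`. -/
def HasValueAbove (f : unitInterval → ℝ) (y : ℕ × ℕ × ℕ) : Prop :=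
  ∃ x : unitInterval, (ratOf y.1 : ℝ) ≤ x ∧ (x : ℝ) ≤ ratOf y.2.1 ∧ (ratOf y.2.2 : ℝ) < f x

/-- `a` computes the values at rational points of the functions `g j`: for a code `r` of a rational
in `[0,1]`, the rational with code `a (j, L, r)` is `g j r` up to an error of `1 / 2 ^ L`. -/
def ApproximatesAtRationals (a : ℕ × ℕ × ℕ → ℕ) (g : ℕ → unitInterval → ℝ) : Prop :=
  ∀ j L r (x : unitInterval), (x : ℝ) = ratOf r → |(ratOf (a (j, L, r)) : ℝ) - g j x| ≤ 1 / 2 ^ L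

theorem ApproximatesAtRationals.neg {a : ℕ × ℕ × ℕ → ℕ} {g : ℕ → unitInterval → ℝ}
    (h : ApproximatesAtRationals a g) : ApproximatesAtRationals (fun z => ratNeg (a z)) (-g) := by
  intro j L r x hx
  rw [ratOf_ratNeg, Rat.cast_neg, Pi.neg_apply, Pi.neg_apply, ← neg_sub', abs_neg]
  exact h j L r x hx

section
variable {ι : Type*} {t : ℕ} {O : ι → List.Vector Arg t} {a : ι → ℕ × ℕ × ℕ → ℕ}

/-- The approximate solvability of finitely many closed conditions is decidable. The conditions
are indexed by the `j < L w` with `J w j`. -/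
theorem uniformlyDecidable_approximate {W : Type} [Primcodable W] (hO : DecidesQuantifier O)
    (ha : UniformlyComputable O a) {y : W → ℕ × ℕ × ℕ} {N L : W → ℕ} {J : W → ℕ → Prop}
    (hy : Primrec y) (hN : Primrec N) (hL : Primrec L)
    (hJ : PrimrecPred fun z : W × ℕ => J z.1 z.2) :
    UniformlyDecidable O fun i w => ∃ r,
      ((0 ≤ ratOf r ∧ ratOf r ≤ 1) ∧ ratOf (y w).1 ≤ ratOf r ∧ ratOf r ≤ ratOf (y w).2.1) ∧
        ∀ j, j < L w → J w j →
          ((ratOf (y w).2.2 + 1 / 2 ^ N w : ℚ) : ℝ) ≤ ratOf (a i (j, L w, r)) + 2 / 2 ^ L w := by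
  have hrange : PrimrecPred fun z : W × ℕ => (0 ≤ ratOf z.2 ∧ ratOf z.2 ≤ 1) ∧
      ratOf (y z.1).1 ≤ ratOf z.2 ∧ ratOf z.2 ≤ ratOf (y z.1).2.1 := by
    have hy' : Primrec fun z : W × ℕ => y z.1 := hy.comp .fst
    refine ((primrecPred_ratOf_nonneg .snd).and ?_).and
      ((primrecPred_ratOf_le (.comp .fst hy') .snd).and
        (primrecPred_ratOf_le .snd (.comp .fst (.comp .snd hy'))))
    exact (primrecPred_ratOf_le .snd (primrec_dyadic (.const 1) (.const 0))).of_eq fun z => by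
      simp [ratOf_dyadic]
  have htest : UniformlyDecidable O fun i (z : (W × ℕ) × ℕ) =>
      ((ratOf (y z.1.1).2.2 + 1 / 2 ^ N z.1.1 : ℚ) : ℝ) ≤
        ratOf (a i (z.2, L z.1.1, z.1.2)) + 2 / 2 ^ L z.1.1 := by
    have hw : Primrec fun z : (W × ℕ) × ℕ => z.1.1 := .comp .fst .fst
    have h1 : PrimrecPred fun z : ((W × ℕ) × ℕ) × ℕ =>
        ratOf (ratAdd (y z.1.1.1).2.2 (dyadic 1 (N z.1.1.1))) ≤
          ratOf (ratAdd z.2 (dyadic 2 (L z.1.1.1))) :=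
      have hw' : Primrec fun z : ((W × ℕ) × ℕ) × ℕ => z.1.1.1 := hw.comp .fst
      primrecPred_ratOf_le
        (primrec_ratAdd (.comp .snd (.comp .snd (hy.comp hw')))
          (primrec_dyadic (.const 1) (hN.comp hw')))
        (primrec_ratAdd .snd (primrec_dyadic (.const 2) (hL.comp hw')))
    refine ((UniformlyDecidable.of_primrec h1).comp (UniformlyComputable.pair
      (.of_primrec .id) (ha.comp (.of_primrec
        (Primrec.pair .snd (.pair (hL.comp hw) (.comp .snd .fst))))))).of_iff fun i z => ?_
    simp only [ratOf_ratAdd, ratOf_dyadic, id]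
    rw [← Rat.cast_le (K := ℝ)]
    push_cast
    rfl
  have hlt : PrimrecPred fun z : (W × ℕ) × ℕ => z.2 < L z.1.1 :=
    Primrec.nat_lt.comp .snd (hL.comp (.comp .fst .fst))
  have hJ' : PrimrecPred fun z : (W × ℕ) × ℕ => J z.1.1 z.2 :=
    hJ.comp (.pair (.comp .fst .fst) .snd)
  have hall := hO.all
    ((UniformlyDecidable.of_primrec hlt).imp ((UniformlyDecidable.of_primrec hJ').imp htest))
  exact hO ((UniformlyDecidable.of_primrec hrange).and hall)

/-- For a Baire 1 function, a witness is a real at which `g n` exceeds a bound for all `n ≥ N`. By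
compactness, the real can be replaced by approximate rational solutions. -/
theorem uniformlyDecidable_hasValueAbove_of_baireOne (hO : DecidesQuantifier O)
    (ha : UniformlyComputable O a) {g : ι → ℕ → unitInterval → ℝ} {f : ι → unitInterval → ℝ}
    (hg : ∀ i, IsBaireOneRep (g i) (f i)) (hag : ∀ i, ApproximatesAtRationals (a i) (g i)) :
    UniformlyDecidable O fun i => HasValueAbove (f i) := by
  have happ := uniformlyDecidable_approximate (W := ((ℕ × ℕ × ℕ) × ℕ) × ℕ) (y := fun w => w.1.1)
    (N := fun w => w.1.2) (L := fun w => w.2) (J := fun w j => w.1.2 ≤ j) hO ha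
    (.comp .fst .fst) (.comp .snd .fst) .snd
    (Primrec.nat_le.comp (.comp .snd (.comp .fst .fst)) .snd)
  have hdec := hO (hO.all happ)
  refine hdec.of_iff fun i y => ?_
  have h (N : ℕ) := exists_forall_le_iff (hg i).1 (hag i) (fun j => N ≤ j)
    (ratOf y.1) (ratOf y.2.1) ((ratOf y.2.2 + 1 / 2 ^ N : ℚ) : ℝ)
  simp only [← h, HasValueAbove, lt_lim_iff ((hg i).2 _)]
  push_cast
  constructor
  · rintro ⟨N, x, hp, hq, hx⟩
    exact ⟨x, hp, hq, N, hx⟩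
  · rintro ⟨x, hp, hq, N, hx⟩
    exact ⟨N, x, hp, hq, hx⟩

/-- For an effectively Baire 2 function, a witness consists of a real and of a function `M` that
bounds the inner limits from below. By compactness, only the initial segments of `M` matter. The
double sequence is enumerated by the pairing function. -/
theorem uniformlyDecidable_hasValueAbove_of_baireTwo (k : Fin t)
    (hk : ∀ i, (O i).get k = arg2 suslin2) (ha : UniformlyComputable O a)
    {g : ι → ℕ → ℕ → unitInterval → ℝ} {f : ι → unitInterval → ℝ}
    (hg : ∀ i, IsEffBaireTwoRep (g i) (f i))
    (hag : ∀ i, ApproximatesAtRationals (a i) fun j => g i j.unpair.1 j.unpair.2) :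
    UniformlyDecidable O fun i => HasValueAbove (f i) := by
  have hO : DecidesQuantifier O := decidesQuantifier_of_suslin2 k hk
  have hJ : PrimrecPred fun z : (((ℕ × ℕ × ℕ) × ℕ) × List ℕ) × ℕ =>
      z.1.1.2 ≤ z.2.unpair.1 ∧ z.1.2.getD z.2.unpair.1 0 ≤ z.2.unpair.2 := by
    have h2 : Primrec fun z : (((ℕ × ℕ × ℕ) × ℕ) × List ℕ) × ℕ => z.2.unpair :=
      Primrec.unpair.comp .snd
    exact (Primrec.nat_le.comp (.comp .snd (.comp .fst .fst)) (.comp .fst h2)).and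
      (Primrec.nat_le.comp ((Primrec.list_getD 0).comp (.comp .snd .fst) (.comp .fst h2))
        (.comp .snd h2))
  have happ := uniformlyDecidable_approximate (W := ((ℕ × ℕ × ℕ) × ℕ) × List ℕ)
    (y := fun w => w.1.1) (N := fun w => w.1.2) (L := fun w => w.2.length)
    (J := fun w j => w.1.2 ≤ j.unpair.1 ∧ w.2.getD j.unpair.1 0 ≤ j.unpair.2) hO ha
    (.comp .fst .fst) (.comp .snd .fst) (Primrec.list_length.comp .snd) hJ
  have hdec := hO (happ.exists_forall_initSeg k hk)
  refine hdec.of_iff fun i y => ?_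
  obtain ⟨h, hgh, hhf⟩ := (hg i).2
  have hcrit (N : ℕ) (M : ℕ → ℕ) := exists_forall_le_iff
    (u := fun j => g i j.unpair.1 j.unpair.2) (fun j => (hg i).1 _ _) (hag i)
    (fun j => N ≤ j.unpair.1 ∧ M j.unpair.1 ≤ j.unpair.2)
    (ratOf y.1) (ratOf y.2.1) ((ratOf y.2.2 + 1 / 2 ^ N : ℚ) : ℝ)
  have hget {M : ℕ → ℕ} {L j : ℕ} (hj : j < L) :
      ((List.range L).map M).getD j.unpair.1 0 = M j.unpair.1 := by
    have := (Nat.unpair_left_le j).trans_lt hj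
    simp [List.getD_eq_getElem?_getD, this]
  have hswap : HasValueAbove (f i) y ↔ ∃ (N : ℕ) (M : ℕ → ℕ), ∃ x : unitInterval,
      (ratOf y.1 : ℝ) ≤ x ∧ (x : ℝ) ≤ ratOf y.2.1 ∧ ∀ j : ℕ,
        N ≤ j.unpair.1 ∧ M j.unpair.1 ≤ j.unpair.2 →
          ((ratOf y.2.2 + 1 / 2 ^ N : ℚ) : ℝ) ≤ g i j.unpair.1 j.unpair.2 x := by
    simp only [HasValueAbove, lt_lim_lim_iff (fun n => hgh n _) (hhf _)]
    push_cast
    constructor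
    · rintro ⟨x, hp, hq, N, M, hx⟩
      exact ⟨N, M, x, hp, hq, fun j hj => hx _ _ hj.1 hj.2⟩
    · rintro ⟨N, M, x, hp, hq, hx⟩
      refine ⟨x, hp, hq, N, M, fun n m hn hm => ?_⟩
      simpa using hx (Nat.pair n m) (by simpa using ⟨hn, hm⟩)
  rw [hswap]
  simp only [hcrit, List.length_map, List.length_range]
  refine exists_congr fun N => exists_congr fun M => forall_congr' fun L => exists_congr fun r =>
    and_congr_right fun _ => forall_congr' fun j => forall_congr' fun hj => ?_
  rw [hget hj]

end

/-! ### Suprema, continuity and moduli of continuity -/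

theorem HasValueAbove.iff_lt_of_isLUB {f : unitInterval → ℝ} {p q c : ℕ} {s : ℝ}
    (hs : IsLUB (f '' {x : unitInterval | (ratOf p : ℝ) ≤ x ∧ (x : ℝ) ≤ ratOf q}) s) :
    HasValueAbove f (p, q, c) ↔ (ratOf c : ℝ) < s := by
  rw [lt_isLUB_iff hs]
  simp [HasValueAbove, and_assoc]

/-- The least `j` with `s ≤ j / 2 ^ k` gives a dyadic approximation of `s ∈ [0,1]`. -/
theorem abs_sInf_div_two_pow_sub_le {s : ℝ} (hs : 0 ≤ s) (hs' : s ≤ 1) (k : ℕ) :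
    |(sInf {j : ℕ | s ≤ j / 2 ^ k} : ℕ) / 2 ^ k - s| ≤ 1 / 2 ^ k := by
  have hne : {j : ℕ | s ≤ j / 2 ^ k}.Nonempty := ⟨2 ^ k, by simpa using hs'⟩
  have h1 : s ≤ (sInf {j : ℕ | s ≤ j / 2 ^ k} : ℕ) / 2 ^ k := Nat.sInf_mem hne
  rw [abs_of_nonneg (sub_nonneg.2 h1), sub_le_iff_le_add]
  cases h : sInf {j : ℕ | s ≤ j / 2 ^ k} with
  | zero => rw [Nat.cast_zero, zero_div]; positivity
  | succ n =>
    have h2 : n ∉ {j : ℕ | s ≤ j / 2 ^ k} := Nat.notMem_of_lt_sInf (by omega)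
    have h3 : (n : ℝ) / 2 ^ k < s := by simpa using h2
    rw [Nat.cast_succ, add_div]
    linarith

/-- On a rational interval that contains the `1 / 2 ^ m`-neighbourhood of `x` in its interior, the
values of `f` differ by at most `1 / 2 ^ (k + 2)` from some rational `r`. The condition depends on
the real `x` only, so that the least such `m` does not depend on a name of `x`. The interval may
exceed `[0,1]`, and `x` need not belong to it. -/
def VariesLittle (f : unitInterval → ℝ) (x : ℝ) (k m : ℕ) : Prop :=
  ∃ p q r : ℕ, ((ratOf (ratAdd p (dyadic 1 m)) : ℝ) < x ∧
      x < ratOf (ratAdd q (ratNeg (dyadic 1 m)))) ∧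
    ¬ HasValueAbove f (p, q, ratAdd r (dyadic 1 (k + 2))) ∧
      ¬ HasValueAbove (-f) (p, q, ratAdd (ratNeg r) (dyadic 1 (k + 2)))

theorem VariesLittle.abs_sub_lt {f : unitInterval → ℝ} {x y : unitInterval} {k m : ℕ}
    (h : VariesLittle f x k m) (hxy : |(x : ℝ) - y| < 1 / 2 ^ m) : |f x - f y| < 1 / 2 ^ k := by
  obtain ⟨p, q, r, ⟨hp, hq⟩, h1, h2⟩ := h
  simp only [ratOf_ratAdd, ratOf_ratNeg, ratOf_dyadic] at hp hq
  push_cast at hp hq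
  have hm : (0 : ℝ) < 1 / 2 ^ m := by positivity
  have key (z : unitInterval) (hz : (ratOf p : ℝ) ≤ z) (hz' : (z : ℝ) ≤ ratOf q) :
      |f z - ratOf r| ≤ 1 / 2 ^ (k + 2) := by
    have h1' := not_lt.1 fun h => h1 ⟨z, hz, hz', h⟩
    have h2' := not_lt.1 fun h => h2 ⟨z, hz, hz', h⟩
    simp only [ratOf_ratAdd, ratOf_ratNeg, ratOf_dyadic, Pi.neg_apply] at h1' h2'
    push_cast at h1' h2'
    rw [abs_le]
    constructor <;> linarith
  rw [abs_lt] at hxy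
  have hx := abs_le.1 (key x (by linarith) (by linarith))
  have hy := abs_le.1 (key y (by linarith) (by linarith))
  have h4 : (1 : ℝ) / 2 ^ k = 4 * (1 / 2 ^ (k + 2)) := by rw [pow_add]; ring
  have h0 : (0 : ℝ) < 1 / 2 ^ (k + 2) := by positivity
  rw [abs_lt]
  constructor <;> linarith

/-- Continuity at `x` is expressed by number quantifiers, without mention of the value `f x`. -/
theorem continuousAt_iff_forall_exists_variesLittle {f : unitInterval → ℝ} {x : unitInterval} :
    ContinuousAt f x ↔ ∀ k, ∃ m, VariesLittle f x k m := by
  constructor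
  · intro hf k
    have hε : (0 : ℝ) < 1 / 2 ^ (k + 3) := by positivity
    obtain ⟨δ, hδ, hfδ⟩ := Metric.continuousAt_iff.1 hf _ hε
    obtain ⟨m, hm⟩ := exists_one_div_two_pow_lt hδ
    obtain ⟨p, hp, hp'⟩ := exists_rat_btwn (sub_lt_sub_left hm (x : ℝ))
    obtain ⟨q, hq, hq'⟩ := exists_rat_btwn (add_lt_add_right hm (x : ℝ))
    obtain ⟨r, hr, hr'⟩ := exists_rat_btwn (lt_add_of_pos_right (f x) hε)
    obtain ⟨p, rfl⟩ := exists_ratOf_eq p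
    obtain ⟨q, rfl⟩ := exists_ratOf_eq q
    obtain ⟨r, rfl⟩ := exists_ratOf_eq r
    have h2 : (1 : ℝ) / 2 ^ (k + 2) = 2 * (1 / 2 ^ (k + 3)) := by rw [pow_add, pow_add]; ring
    have key (z : unitInterval) (hz : (ratOf p : ℝ) ≤ z) (hz' : (z : ℝ) ≤ ratOf q) :
        |f z - f x| < 1 / 2 ^ (k + 3) := by
      refine hfδ ?_
      rw [Subtype.dist_eq, Real.dist_eq, abs_lt]
      constructor <;> linarith
    refine ⟨m, p, q, r, ⟨?_, ?_⟩, ?_, ?_⟩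
    · rw [ratOf_ratAdd, ratOf_dyadic]
      push_cast
      linarith
    · rw [ratOf_ratAdd, ratOf_ratNeg, ratOf_dyadic]
      push_cast
      linarith
    · rintro ⟨z, hz, hz', h⟩
      have := abs_lt.1 (key z hz hz')
      simp only [ratOf_ratAdd, ratOf_dyadic] at h
      push_cast at h
      linarith
    · rintro ⟨z, hz, hz', h⟩
      have := abs_lt.1 (key z hz hz')
      simp only [ratOf_ratAdd, ratOf_ratNeg, ratOf_dyadic, Pi.neg_apply] at h
      push_cast at h
      linarith
  · intro h
    rw [Metric.continuousAt_iff]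
    intro ε hε
    obtain ⟨k, hk⟩ := exists_one_div_two_pow_lt hε
    obtain ⟨m, hm⟩ := h k
    refine ⟨1 / 2 ^ m, by positivity, fun y hy => ?_⟩
    rw [dist_comm, Subtype.dist_eq, Real.dist_eq] at hy
    rw [dist_comm, Real.dist_eq]
    exact (hm.abs_sub_lt hy).trans hk

theorem IsName.ratOf_lt_iff {α : ℕ → ℕ} {x : ℝ} (h : IsName α x) (c : ℕ) :
    (ratOf c : ℝ) < x ↔ ∃ n, ratOf (ratAdd c (dyadic 1 n)) < ratOf (α n) := by
  simp only [ratOf_ratAdd, ratOf_dyadic, ← Rat.cast_lt (K := ℝ)]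
  push_cast
  constructor
  · intro hc
    obtain ⟨n, hn⟩ := exists_one_div_two_pow_lt (half_pos (sub_pos.2 hc))
    exact ⟨n, by linarith [(abs_le.1 (h n)).1]⟩
  · rintro ⟨n, hn⟩
    linarith [(abs_le.1 (h n)).2]

theorem IsName.lt_ratOf_iff {α : ℕ → ℕ} {x : ℝ} (h : IsName α x) (c : ℕ) :
    x < ratOf c ↔ ∃ n, ratOf (ratAdd (α n) (dyadic 1 n)) < ratOf c := by
  simp only [ratOf_ratAdd, ratOf_dyadic, ← Rat.cast_lt (K := ℝ)]
  push_cast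
  constructor
  · intro hc
    obtain ⟨n, hn⟩ := exists_one_div_two_pow_lt (half_pos (sub_pos.2 hc))
    exact ⟨n, by linarith [(abs_le.1 (h n)).2]⟩
  · rintro ⟨n, hn⟩
    linarith [(abs_le.1 (h n)).1]

/-- A real together with one of its names. -/
abbrev NamedReal : Type := {z : ℝ × (ℕ → ℕ) // IsName z.2 z.1}

section
variable {ι : Type*} {t : ℕ} {O : ι → List.Vector Arg t} {f : ι → unitInterval → ℝ}

theorem exists_computesSup (hO : DecidesQuantifier O)
    (hf : UniformlyDecidable O fun i => HasValueAbove (f i)) :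
    ∃ e, ∀ i, (∀ x, f i x ∈ Set.Icc (0 : ℝ) 1) → ComputesSup e (O i).toList (f i) := by
  -- the argument is the triple `k, p, q`
  have hP : UniformlyDecidable O fun i (z : (ℕ × ℕ × ℕ) × ℕ) =>
      ¬ HasValueAbove (f i) (z.1.2.1, z.1.2.2, dyadic z.2 z.1.1) :=
    (hf.comp_primrec (.pair (.comp .fst (.comp .snd .fst)) (.pair (.comp .snd (.comp .snd .fst))
      (primrec_dyadic .snd (.comp .fst .fst))))).not
  have hsup := UniformlyComputable.primrec_comp
    (f := fun z : ℕ × ℕ => dyadic z.1 z.2) (primrec_dyadic .fst .snd)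
    ((hO.sInf hP).pair (.of_primrec (Primrec.fst (α := ℕ) (β := ℕ × ℕ))))
  obtain ⟨e, he⟩ := hsup
  obtain ⟨e', he'⟩ := exists_subst_oracle (m := 3) O (primrec_vector_singleton
    (Primrec₂.natPair.comp (primrec_get 0)
      (Primrec₂.natPair.comp (primrec_get 1) (primrec_get 2)))) e
  refine ⟨e', fun i hf01 p q hp hpq hq => ?_⟩
  have hne : (f i '' {x : unitInterval | (ratOf p : ℝ) ≤ x ∧ (x : ℝ) ≤ ratOf q}).Nonempty :=
    ⟨_, ⟨ratOf p, by exact_mod_cast hp, by exact_mod_cast hpq.trans hq⟩,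
      ⟨le_rfl, Rat.cast_le.2 hpq⟩, rfl⟩
  have hbdd : ∀ y ∈ f i '' {x : unitInterval | (ratOf p : ℝ) ≤ x ∧ (x : ℝ) ≤ ratOf q},
      y ∈ Set.Icc (0 : ℝ) 1 := by
    rintro _ ⟨x, _, rfl⟩
    exact hf01 x
  have hs := isLUB_csSup hne ⟨1, fun y hy => (hbdd y hy).2⟩
  refine ⟨_, fun k => dyadic (sInf {j | ¬ HasValueAbove (f i) (p, q, dyadic j k)}) k, hs,
    fun k => ?_, fun k => ?_⟩
  · obtain ⟨y, hy⟩ := hne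
    simp only [HasValueAbove.iff_lt_of_isLUB hs, not_lt, ratOf_dyadic]
    push_cast
    exact abs_sInf_div_two_pow_sub_le ((hbdd y hy).1.trans (hs.1 hy))
      (hs.2 fun y hy => (hbdd y hy).2) k
  · simpa using he' i (k ::ᵥ p ::ᵥ q ::ᵥ .nil) [] _
      (by simpa using he i (k, p, q) [arg0 k, arg0 p, arg0 q])

/-- The real `x` enters only through strict inequalities with rationals, each of which is an
existential statement about a name of `x`. -/
theorem uniformlyDecidable_variesLittle
    (hO : DecidesQuantifier fun p : ι × NamedReal => arg1 p.2.1.2 ::ᵥ O p.1)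
    (hf : UniformlyDecidable O fun i => HasValueAbove (f i))
    (hf' : UniformlyDecidable O fun i => HasValueAbove (-f i)) :
    UniformlyDecidable (fun p : ι × NamedReal => arg1 p.2.1.2 ::ᵥ O p.1)
      fun p (z : ℕ × ℕ) => VariesLittle (f p.1) p.2.1.1 z.1 z.2 := by
  have hα : UniformlyComputable (fun p : ι × NamedReal => arg1 p.2.1.2 ::ᵥ O p.1)
      fun p => p.2.1.2 := .apply₁ 0 fun _ => rfl
  have hpair := UniformlyComputable.pair
    (.of_primrec (Primrec.id (α := ℕ × ℕ))) (hα.comp (.of_primrec (Primrec.snd (α := ℕ) (β := ℕ))))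
  have hgt := hO (((UniformlyDecidable.of_primrec (p := fun z : (ℕ × ℕ) × ℕ =>
    ratOf z.2 ≤ ratOf (ratAdd z.1.1 (dyadic 1 z.1.2))) (primrecPred_ratOf_le .snd
      (primrec_ratAdd (.comp .fst .fst) (primrec_dyadic (.const 1) (.comp .snd .fst))))).comp
    hpair).not)
  have hlt := hO (((UniformlyDecidable.of_primrec (p := fun z : (ℕ × ℕ) × ℕ =>
    ratOf z.1.1 ≤ ratOf (ratAdd z.2 (dyadic 1 z.1.2))) (primrecPred_ratOf_le (.comp .fst .fst)
      (primrec_ratAdd .snd (primrec_dyadic (.const 1) (.comp .snd .fst))))).comp hpair).not)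
  -- the variables `k, m, p, q, r` are `z.1.1.1.1, z.1.1.1.2, z.1.1.2, z.1.2, z.2`
  have hk : Primrec fun z : (((ℕ × ℕ) × ℕ) × ℕ) × ℕ => z.1.1.1.1 :=
    .comp .fst (.comp .fst (.comp .fst .fst))
  have hm : Primrec fun z : (((ℕ × ℕ) × ℕ) × ℕ) × ℕ => z.1.1.1.2 :=
    .comp .snd (.comp .fst (.comp .fst .fst))
  have hp : Primrec fun z : (((ℕ × ℕ) × ℕ) × ℕ) × ℕ => z.1.1.2 := .comp .snd (.comp .fst .fst)
  have hq : Primrec fun z : (((ℕ × ℕ) × ℕ) × ℕ) × ℕ => z.1.2 := .comp .snd .fst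
  have hr : Primrec fun z : (((ℕ × ℕ) × ℕ) × ℕ) × ℕ => z.2 := .snd
  have hk2 : Primrec fun z : (((ℕ × ℕ) × ℕ) × ℕ) × ℕ => dyadic 1 (z.1.1.1.1 + 2) :=
    primrec_dyadic (.const 1) (Primrec.nat_add.comp hk (.const 2))
  have h1 := hgt.comp_primrec (primrec_ratAdd hp (primrec_dyadic (.const 1) hm))
  have h2 := hlt.comp_primrec (primrec_ratAdd hq (primrec_ratNeg (primrec_dyadic (.const 1) hm)))
  have h3 := ((hf.cons fun z : NamedReal => arg1 z.1.2).comp_primrec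
    (.pair hp (.pair hq (primrec_ratAdd hr hk2)))).not
  have h4 := ((hf'.cons fun z : NamedReal => arg1 z.1.2).comp_primrec
    (.pair hp (.pair hq (primrec_ratAdd (primrec_ratNeg hr) hk2)))).not
  refine (hO (hO (hO ((h1.and h2).and (h3.and h4))))).of_iff fun p z => ?_
  simp only [VariesLittle, p.2.2.ratOf_lt_iff, p.2.2.lt_ratOf_iff, not_le, id]

theorem exists_decidesContinuity
    (hO : DecidesQuantifier fun p : ι × NamedReal => arg1 p.2.1.2 ::ᵥ O p.1)
    (hf : UniformlyDecidable O fun i => HasValueAbove (f i))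
    (hf' : UniformlyDecidable O fun i => HasValueAbove (-f i)) :
    ∃ e, ∀ i, DecidesContinuity e (O i).toList (f i) := by
  have hV := uniformlyDecidable_variesLittle hO hf hf'
  -- a dummy number argument is added, and the output is negated
  obtain ⟨e, he⟩ := (hO.all (hO (hV.comp_primrec (g := fun z : (ℕ × ℕ) × ℕ => (z.1.2, z.2))
    (.pair (.comp .snd .fst) .snd)))).not
  refine ⟨Nat.pair 4 (Nat.pair e (Nat.pair 2 0)), fun i x α hα => ?_⟩
  have h := he (i, ⟨(x, α), hα⟩) 0 []
  rw [continuousAt_iff_forall_exists_variesLittle]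
  constructor <;> intro hx
  · exact Computes.s4 (Computes.s2 0 _) (by simpa [hx] using h)
  · exact Computes.s4 (Computes.s2 0 _) (by simpa [hx] using h)

theorem exists_computesModulus
    (hO : DecidesQuantifier fun p : ι × NamedReal => arg1 p.2.1.2 ::ᵥ O p.1)
    (hf : UniformlyDecidable O fun i => HasValueAbove (f i))
    (hf' : UniformlyDecidable O fun i => HasValueAbove (-f i)) :
    ∃ e, ∀ i, ComputesModulus e (O i).toList (f i) := by
  obtain ⟨e, he⟩ := hO.sInf (uniformlyDecidable_variesLittle hO hf hf')
  refine ⟨e, fun i => ⟨fun x k => sInf {m | VariesLittle (f i) x k m}, ?_, fun x α hα k => ?_⟩⟩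
  · intro k x hx y hxy
    have hne : {m | VariesLittle (f i) x k m}.Nonempty :=
      continuousAt_iff_forall_exists_variesLittle.1 hx k
    exact (Nat.sInf_mem hne : VariesLittle (f i) x k _).abs_sub_lt hxy
  · simpa using he (i, ⟨(x, α), hα⟩) k []

end

/-! ### The two classes of inputs -/

theorem primrec_prepend {X : Type*} [Primcodable X] {h : X → ℕ} {β : X → ℕ → ℕ} (hh : Primrec h)
    (hβ : Primrec fun z : X × ℕ => β z.1 z.2) :
    Primrec fun z : X × ℕ => prepend (h z.1) (β z.1) z.2 := by
  refine (Primrec.ite (Primrec.eq.comp .snd (.const 0)) (hh.comp .fst)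
    (hβ.comp (.pair .fst (Primrec.pred.comp .snd)))).of_eq fun z => ?_
  rcases z with ⟨x, _ | n⟩ <;> simp [prepend]

theorem primrec_prepend_const :
    Primrec fun z : (ℕ × ℕ × ℕ) × ℕ => prepend z.1.2.1 (fun _ => z.1.2.2) z.2 :=
  primrec_prepend (h := fun z : ℕ × ℕ × ℕ => z.2.1) (β := fun z _ => z.2.2) (.comp .fst .snd)
    (.comp .snd (.comp .snd .fst))

/-- A function with a representation as a Baire 1 function, for the oracle `∃²`. The values of `f`
are accessed as limits of those of `g`, and `Φ` is only carried along as an argument. -/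
structure BaireOneInput where
  f : unitInterval → ℝ
  g : ℕ → unitInterval → ℝ
  Φ : (ℕ → ℕ) → ℕ
  G : (ℕ → ℕ) → ℕ
  rep : IsBaireOneRep g f
  seq : RepresentsSeq G g

namespace BaireOneInput

/-- The arguments of type 2 of a computation. -/
noncomputable def oracles (i : BaireOneInput) : List.Vector Arg 3 :=
  ⟨[arg2 i.Φ, arg2 i.G, arg2 exists2], rfl⟩

/-- The code of the approximation of `g n r` with error `1 / 2 ^ L`, for `z = (n, L, r)`. A rational
has the constant sequence as a name. -/
def approx (i : BaireOneInput) (z : ℕ × ℕ × ℕ) : ℕ :=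
  i.G (prepend z.1 (prepend z.2.1 fun _ => z.2.2))

theorem uniformlyComputable_approx : UniformlyComputable oracles approx :=
  .apply₂ (F := G) 1 (fun _ => rfl) (.of_primrec
    (primrec_prepend (β := fun z : ℕ × ℕ × ℕ => prepend z.2.1 fun _ => z.2.2) .fst
      primrec_prepend_const))

theorem approximatesAtRationals (i : BaireOneInput) : ApproximatesAtRationals i.approx i.g :=
  fun j L _ x hx => i.seq j x _ (isName_const hx) L

theorem rep_neg (i : BaireOneInput) : IsBaireOneRep (-i.g) (-i.f) :=
  ⟨fun n => (i.rep.1 n).neg, fun x => (i.rep.2 x).neg⟩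

theorem decidesQuantifier : DecidesQuantifier oracles :=
  decidesQuantifier_of_exists2 2 fun _ => rfl

theorem decidesQuantifier_name :
    DecidesQuantifier fun p : BaireOneInput × NamedReal => arg1 p.2.1.2 ::ᵥ p.1.oracles :=
  decidesQuantifier_of_exists2 3 fun _ => rfl

theorem uniformlyDecidable : UniformlyDecidable oracles fun i => HasValueAbove i.f :=
  uniformlyDecidable_hasValueAbove_of_baireOne decidesQuantifier uniformlyComputable_approx rep
    approximatesAtRationals

theorem uniformlyDecidable_neg : UniformlyDecidable oracles fun i => HasValueAbove (-i.f) :=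
  uniformlyDecidable_hasValueAbove_of_baireOne decidesQuantifier
    (.primrec_comp (primrec_ratNeg .id) uniformlyComputable_approx) rep_neg
    fun i => i.approximatesAtRationals.neg

end BaireOneInput

/-- A function with a representation as an effectively Baire 2 function, for the oracle `S²`. As in
`BaireOneInput`, `Φ` is only carried along. -/
structure BaireTwoInput where
  f : unitInterval → ℝ
  g : ℕ → ℕ → unitInterval → ℝ
  Φ : (ℕ → ℕ) → ℕ
  G : (ℕ → ℕ) → ℕ
  rep : IsEffBaireTwoRep g f
  seq : RepresentsDoubleSeq G g

namespace BaireTwoInput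

/-- The arguments of type 2 of a computation. -/
noncomputable def oracles (i : BaireTwoInput) : List.Vector Arg 3 :=
  ⟨[arg2 i.Φ, arg2 i.G, arg2 suslin2], rfl⟩

/-- The code of the approximation of `g n m r` with error `1 / 2 ^ L`, for `z = (⟨n, m⟩, L, r)`. -/
def approx (i : BaireTwoInput) (z : ℕ × ℕ × ℕ) : ℕ :=
  i.G (prepend z.1.unpair.1 (prepend z.1.unpair.2 (prepend z.2.1 fun _ => z.2.2)))

theorem uniformlyComputable_approx : UniformlyComputable oracles approx :=
  have h : Primrec fun z : ℕ × ℕ × ℕ => z.1.unpair := Primrec.unpair.comp .fst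
  .apply₂ (F := G) 1 (fun _ => rfl) (.of_primrec
    (primrec_prepend (β := fun z : ℕ × ℕ × ℕ =>
        prepend z.1.unpair.2 (prepend z.2.1 fun _ => z.2.2)) (.comp .fst h)
      (primrec_prepend (β := fun z : ℕ × ℕ × ℕ => prepend z.2.1 fun _ => z.2.2) (.comp .snd h)
        primrec_prepend_const)))

theorem approximatesAtRationals (i : BaireTwoInput) :
    ApproximatesAtRationals i.approx fun j => i.g j.unpair.1 j.unpair.2 :=
  fun j L _ x hx => i.seq j.unpair.1 j.unpair.2 x _ (isName_const hx) L

theorem rep_neg (i : BaireTwoInput) : IsEffBaireTwoRep (-i.g) (-i.f) := by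
  obtain ⟨h, hgh, hhf⟩ := i.rep.2
  exact ⟨fun n m => (i.rep.1 n m).neg, -h, fun n x => (hgh n x).neg, fun x => (hhf x).neg⟩

theorem decidesQuantifier : DecidesQuantifier oracles :=
  decidesQuantifier_of_suslin2 2 fun _ => rfl

theorem decidesQuantifier_name :
    DecidesQuantifier fun p : BaireTwoInput × NamedReal => arg1 p.2.1.2 ::ᵥ p.1.oracles :=
  decidesQuantifier_of_suslin2 3 fun _ => rfl

theorem uniformlyDecidable : UniformlyDecidable oracles fun i => HasValueAbove i.f :=
  uniformlyDecidable_hasValueAbove_of_baireTwo 2 (fun _ => rfl) uniformlyComputable_approx rep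
    approximatesAtRationals

theorem uniformlyDecidable_neg : UniformlyDecidable oracles fun i => HasValueAbove (-i.f) :=
  uniformlyDecidable_hasValueAbove_of_baireTwo 2 (fun _ => rfl)
    (.primrec_comp (primrec_ratNeg .id) uniformlyComputable_approx) rep_neg
    fun i => i.approximatesAtRationals.neg

end BaireTwoInput

end Kleene

open Kleene in
theorem theorem2p9 :
    -- Baire 1 functions and the oracle `∃²`
    (∃ e : ℕ, ∀ (f : unitInterval → ℝ) (g : ℕ → unitInterval → ℝ) (Φ G : (ℕ → ℕ) → ℕ),
      (∀ x, f x ∈ Set.Icc (0 : ℝ) 1) → IsBaireOneRep g f →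
      RepresentsFun Φ f → RepresentsSeq G g →
      ComputesSup e [arg2 Φ, arg2 G, arg2 exists2] f) ∧
    (∃ e : ℕ, ∀ (f : unitInterval → ℝ) (g : ℕ → unitInterval → ℝ) (Φ G : (ℕ → ℕ) → ℕ),
      IsBaireOneRep g f → RepresentsFun Φ f → RepresentsSeq G g →
      DecidesContinuity e [arg2 Φ, arg2 G, arg2 exists2] f) ∧
    (∃ e : ℕ, ∀ (f : unitInterval → ℝ) (g : ℕ → unitInterval → ℝ) (Φ G : (ℕ → ℕ) → ℕ),
      IsBaireOneRep g f → RepresentsFun Φ f → RepresentsSeq G g →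
      ComputesModulus e [arg2 Φ, arg2 G, arg2 exists2] f) ∧
    -- effectively Baire 2 functions and the oracle `S²`
    (∃ e : ℕ, ∀ (f : unitInterval → ℝ) (g : ℕ → ℕ → unitInterval → ℝ) (Φ G : (ℕ → ℕ) → ℕ),
      (∀ x, f x ∈ Set.Icc (0 : ℝ) 1) → IsEffBaireTwoRep g f →
      RepresentsFun Φ f → RepresentsDoubleSeq G g →
      ComputesSup e [arg2 Φ, arg2 G, arg2 suslin2] f) ∧
    (∃ e : ℕ, ∀ (f : unitInterval → ℝ) (g : ℕ → ℕ → unitInterval → ℝ) (Φ G : (ℕ → ℕ) → ℕ),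
      (∀ x, f x ∈ Set.Icc (0 : ℝ) 1) → IsEffBaireTwoRep g f →
      RepresentsFun Φ f → RepresentsDoubleSeq G g →
      DecidesContinuity e [arg2 Φ, arg2 G, arg2 suslin2] f) ∧
    (∃ e : ℕ, ∀ (f : unitInterval → ℝ) (g : ℕ → ℕ → unitInterval → ℝ) (Φ G : (ℕ → ℕ) → ℕ),
      IsEffBaireTwoRep g f → RepresentsFun Φ f → RepresentsDoubleSeq G g →
      ComputesModulus e [arg2 Φ, arg2 G, arg2 suslin2] f) := by
  obtain ⟨a, ha⟩ := exists_computesSup BaireOneInput.decidesQuantifier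
    BaireOneInput.uniformlyDecidable
  obtain ⟨b, hb⟩ := exists_decidesContinuity BaireOneInput.decidesQuantifier_name
    BaireOneInput.uniformlyDecidable BaireOneInput.uniformlyDecidable_neg
  obtain ⟨c, hc⟩ := exists_computesModulus BaireOneInput.decidesQuantifier_name
    BaireOneInput.uniformlyDecidable BaireOneInput.uniformlyDecidable_neg
  obtain ⟨a', ha'⟩ := exists_computesSup BaireTwoInput.decidesQuantifier
    BaireTwoInput.uniformlyDecidable
  obtain ⟨b', hb'⟩ := exists_decidesContinuity BaireTwoInput.decidesQuantifier_name
    BaireTwoInput.uniformlyDecidable BaireTwoInput.uniformlyDecidable_neg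
  obtain ⟨c', hc'⟩ := exists_computesModulus BaireTwoInput.decidesQuantifier_name
    BaireTwoInput.uniformlyDecidable BaireTwoInput.uniformlyDecidable_neg
  exact ⟨⟨a, fun f g Φ G h01 hf _ hG => ha ⟨f, g, Φ, G, hf, hG⟩ h01⟩,
    ⟨b, fun f g Φ G hf _ hG => hb ⟨f, g, Φ, G, hf, hG⟩⟩,
    ⟨c, fun f g Φ G hf _ hG => hc ⟨f, g, Φ, G, hf, hG⟩⟩,
    ⟨a', fun f g Φ G h01 hf _ hG => ha' ⟨f, g, Φ, G, hf, hG⟩ h01⟩,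
    ⟨b', fun f g Φ G _ hf _ hG => hb' ⟨f, g, Φ, G, hf, hG⟩⟩,
    ⟨c', fun f g Φ G hf _ hG => hc' ⟨f, g, Φ, G, hf, hG⟩⟩⟩
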